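/- Let $0<\epsilon<1$, $a=\tan\frac{\pi\epsilon}{2}$ and $V(x)=\ln(1+x^2)$. For $n\ge 1$ let $(t_1,\dots,t_n)\in[-a,a]^n$ have the law with density proportional to $$\prod_{1\le i<j\le n}(t_i-t_j)^2\; e^{-n\sum_{k=1}^n V(t_k)}$$ with respect to Lebesgue measure on $[-a,a]^n$ (this is the integrand of the integral $Z_n(a)$). Put $$\nu(x)=\frac{1}{\pi\cos(\frac{\pi\epsilon}{2})\,(1+x^2)\sqrt{\tan^2(\frac{\pi\epsilon}{2})-x^2}}\,\mathbf 1_{[-a,a]}(x),\qquad d\mu_\infty(x)=\nu(x)\,dx .$$ Then $\mu_\infty$ is a probability measure and it is the limiting eigenvalue distribution: the empirical measures $\frac1n\sum_{i=1}^n\delta_{t_i}$ converge weakly to $\mu_\infty$ almost surely, whatever the joint law of the eigenvalue vectors for different $n$, and $\mu_\infty$ is the only measure with this property. It is also the equilibrium measure, that is, the unique minimizer, with finite energy, of $$\mu\mapsto\int V\,d\mu-\iint\ln|x-y|\,d\mu(x)\,d\mu(y)$$ among probability measures on $[-a,a]$. Moreover the following conditions (Hypothesis 1.1 of Borot and Guionnet)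 hold with integration domain $[b_-,b_+]=[-a,a]$ and with $[\alpha_-,\alpha_+]=[-a,a]$: 1. (Regularity) $V$ is continuous on $[b_-,b_+]$. 2. (Confinement) If $+\infty$ (resp. $-\infty$) is an endpoint of the integration domain, then $\liminf \frac{V(x)}{2\ln|x|}>1$ as $x\to+\infty$ (resp. $x\to-\infty$). (This is void here, since the domain is bounded.) 3. (One-cut regime) The support of $\mu_\infty$ is the single interval $[\alpha_-,\alpha_+]$, which is not reduced to a point. 4. (Control of large deviations) The function $x\mapsto\frac12V(x)-\int\ln|x-\xi|\,d\mu_\infty(\xi)$ is well defined on $[b_-,b_+]\setminus(\alpha_-,\alpha_+)$ (the integral converges absolutely), attains its minimum there, and attains it only at $\alpha_-$ or $\alpha_+$. 5. (Off-criticality) The density $\nu$ is continuous and strictly positive on $(\alpha_-,\alpha_+)$. As $x\to\alpha_\pm$ from inside the support, $\nu(x)$ is of exact order $|x-\alpha_\pm|^{-1/2}$ if the edge is hard ($\alpha_\pm=b_\pm$, as is the case here) and of exact order $|x-\alpha_\pm|^{1/2}$ if it is soft ($\alpha_\pm\ne b_\pm$). Here, $f$ is of exact order $g$ when $f/g$ is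 bounded above and bounded away from $0$ near the edge. 6. (Analyticity) $V$ extends to an analytic function in a complex neighbourhood of $[\alpha_-,\alpha_+]$. -/

import Mathlib

open MeasureTheory Filter Topology Set
open scoped BoundedContinuousFunction

namespace LogGas

/-- The integration domain `[b₋, b₊] ∩ ℝ`, where `b₋ = -∞` and `b₊ = +∞` are allowed. -/
def domain (bm bp : EReal) : Set ℝ :=
  {x : ℝ | bm ≤ (x : EReal) ∧ (x : EReal) ≤ bp}

/-- The unnormalised eigenvalue measure
`Δ(t₁, …, tₙ)² exp (- n ∑ₖ V (tₖ)) dt₁ ⋯ dtₙ` on `[b₋, b₊]ⁿ`, with `Δ` the Vandermonde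
determinant. -/
noncomputable def weightMeasure (V : ℝ → ℝ) (bm bp : EReal) (n : ℕ) : Measure (Fin n → ℝ) :=
  (volume.restrict (Set.univ.pi fun _ => domain bm bp)).withDensity fun t =>
    ENNReal.ofReal ((Matrix.vandermonde t).det ^ 2 * Real.exp (-(n : ℝ) * ∑ k, V (t k)))

/-- The law of the `n` eigenvalues: the eigenvalue measure divided by its total mass. -/
noncomputable def eigenvalueLaw (V : ℝ → ℝ) (bm bp : EReal) (n : ℕ) : Measure (Fin n → ℝ) :=
  (weightMeasure V bm bp n Set.univ)⁻¹ • weightMeasure V bm bp n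

/-- The empirical measure `(1/n) ∑ᵢ δ_{tᵢ}`. -/
noncomputable def empiricalMeasure (n : ℕ) (t : Fin n → ℝ) : Measure ℝ :=
  (n : ENNReal)⁻¹ • ∑ i, Measure.dirac (t i)

/-- `μ` is the almost sure weak limit of the empirical measures of the eigenvalues. The
eigenvalues for different `n` may be realised on one probability space in any way: `P` runs over
all joint laws of the vectors `t⁽⁰⁾, t⁽¹⁾, t⁽²⁾, …` in which `t⁽ⁿ⁾` has the law of the `n`
eigenvalues. -/
structure IsLimitingEigenvalueMeasure (V : ℝ → ℝ) (bm bp : EReal) (μ : Measure ℝ) : Prop where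
  isProbability : IsProbabilityMeasure μ
  tendsto : ∀ P : Measure ((n : ℕ) → (Fin n → ℝ)), IsProbabilityMeasure P →
    (∀ n, P.map (fun t => t n) = eigenvalueLaw V bm bp n) →
    ∀ᵐ t ∂P, ∀ f : ℝ →ᵇ ℝ,
      Tendsto (fun n => ∫ x, f x ∂(empiricalMeasure n (t n))) atTop (𝓝 (∫ x, f x ∂μ))

open Classical in
/-- The energy kernel `(V x + V y) / 2 - log |x - y|`, equal to `+∞` on the diagonal. -/
noncomputable def energyKernel (V : ℝ → ℝ) (p : ℝ × ℝ) : EReal :=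
  if p.1 = p.2 then ⊤ else (((V p.1 + V p.2) / 2 - Real.log |p.1 - p.2| : ℝ) : EReal)

/-- The energy `∬ ((V x + V y) / 2 - log |x - y|) dν(x) dν(y)`, that is,
`∫ V dν - ∬ log |x - y| dν(x) dν(y)`, as the integral of the positive part of the kernel minus
the integral of its negative part. -/
noncomputable def energy (V : ℝ → ℝ) (ν : Measure ℝ) : EReal :=
  ((∫⁻ p, (energyKernel V p).toENNReal ∂(ν.prod ν) : ENNReal) : EReal) -
    ((∫⁻ p, (-energyKernel V p).toENNReal ∂(ν.prod ν) : ENNReal) : EReal)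

/-- `μ` is the equilibrium measure: the unique minimiser of the energy, with finite energy, among
the probability measures on the integration domain. -/
structure IsEquilibriumMeasure (V : ℝ → ℝ) (bm bp : EReal) (μ : Measure ℝ) : Prop where
  isProbability : IsProbabilityMeasure μ
  domain_compl : μ (domain bm bp)ᶜ = 0
  energy_ne_bot : energy V μ ≠ ⊥
  energy_ne_top : energy V μ ≠ ⊤
  energy_lt : ∀ ν : Measure ℝ, IsProbabilityMeasure ν → ν (domain bm bp)ᶜ = 0 → ν ≠ μ →
    energy V μ < energy V ν

/-- The measure `ρ(x) dx` on the real line. -/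
noncomputable def densityMeasure (ρ : ℝ → ℝ) : Measure ℝ :=
  volume.withDensity fun x => ENNReal.ofReal (ρ x)

/-- The function `x ↦ V x / 2 - ∫ log |x - ξ| dμ(ξ)`. -/
noncomputable def effectivePotential (V : ℝ → ℝ) (μ : Measure ℝ) (x : ℝ) : ℝ :=
  V x / 2 - ∫ ξ, Real.log |x - ξ| ∂μ

/-- The Borot–Guionnet conditions for a potential `V` (independent of `n`) on the integration
domain `[b₋, b₊]`, where `ρ` is the density of the limiting eigenvalue measure and `α₋, α₊` are
the edges of its support. An edge `α` is hard if it is an endpoint of the integration domain, and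
soft otherwise. -/
structure BorotGuionnetConditions (V : ℝ → ℝ) (bm bp : EReal) (αm αp : ℝ) (ρ : ℝ → ℝ) :
    Prop where
  /-- Regularity. -/
  regularity : ContinuousOn V (domain bm bp)
  /-- Confinement at `+∞`. -/
  confinement_top : bp = ⊤ →
    1 < liminf (fun x : ℝ => ((V x / (2 * Real.log |x|) : ℝ) : EReal)) atTop
  /-- Confinement at `-∞`. -/
  confinement_bot : bm = ⊥ →
    1 < liminf (fun x : ℝ => ((V x / (2 * Real.log |x|) : ℝ) : EReal)) atBot
  /-- One-cut regime: the support is a single interval ... -/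
  support_eq : (densityMeasure ρ).support = Icc αm αp
  /-- ... which is not reduced to a point. -/
  nondegenerate : αm < αp
  /-- Control of large deviations: the logarithmic potential is well defined ... -/
  log_integrable : ∀ x ∈ domain bm bp \ Ioo αm αp,
    Integrable (fun ξ => Real.log |x - ξ|) (densityMeasure ρ)
  /-- ... the effective potential attains its minimum on the complement of the cut ... -/
  exists_min : ∃ x ∈ domain bm bp \ Ioo αm αp,
    IsMinOn (effectivePotential V (densityMeasure ρ)) (domain bm bp \ Ioo αm αp) x
  /-- ... and does so at the edges only. -/
  min_only : ∀ x ∈ domain bm bp \ Ioo αm αp,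
    IsMinOn (effectivePotential V (densityMeasure ρ)) (domain bm bp \ Ioo αm αp) x →
      x = αm ∨ x = αp
  /-- Off-criticality: the density is continuous and positive inside the support ... -/
  density_continuousOn : ContinuousOn ρ (Ioo αm αp)
  density_pos : ∀ x ∈ Ioo αm αp, 0 < ρ x
  /-- ... and has the exact order `|x - α|^(-1/2)` at a hard edge ... -/
  hard_left : (αm : EReal) = bm → ρ =Θ[𝓝[>] αm] fun x => 1 / Real.sqrt |x - αm|
  hard_right : (αp : EReal) = bp → ρ =Θ[𝓝[<] αp] fun x => 1 / Real.sqrt |x - αp|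
  /-- ... and `|x - α|^(1/2)` at a soft edge. -/
  soft_left : (αm : EReal) ≠ bm → ρ =Θ[𝓝[>] αm] fun x => Real.sqrt |x - αm|
  soft_right : (αp : EReal) ≠ bp → ρ =Θ[𝓝[<] αp] fun x => Real.sqrt |x - αp|
  /-- Analyticity: `V` extends analytically to a complex neighbourhood of `[α₋, α₊]`. -/
  analyticity : ∃ (U : Set ℂ) (F : ℂ → ℂ), IsOpen U ∧ (∀ x ∈ Icc αm αp, (x : ℂ) ∈ U) ∧
    AnalyticOnNhd ℂ F U ∧ ∀ x ∈ domain bm bp, (x : ℂ) ∈ U → F x = V x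

/-- The density `1 / (π cos(πε/2) (1 + x²) √(tan²(πε/2) - x²))` on
`[-tan(πε/2), tan(πε/2)]`, and `0` elsewhere. -/
noncomputable def arcDensity (ε : ℝ) : ℝ → ℝ :=
  Set.indicator (Icc (-Real.tan (Real.pi * ε / 2)) (Real.tan (Real.pi * ε / 2))) fun x =>
    1 / (Real.pi * Real.cos (Real.pi * ε / 2) * (1 + x ^ 2) *
      Real.sqrt (Real.tan (Real.pi * ε / 2) ^ 2 - x ^ 2))

end LogGas

/-!
In the angular coordinate `x = tan φ` the weight becomes `∏_{i<j} sin² (φᵢ - φⱼ)`: the energy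
kernel is `-log |sin (φ - ψ)| = -(1/2) log (chordalSq x y)`, which is nonnegative, and `chordalSq`
is a quarter of the squared distance of the images of `x` and `y` on the unit circle under the
Cayley transform.

*Euler–Lagrange equation.* The measure with density `arcDensity ε` is the image of the arcsine law
on `[-b, b]`, where `b = sin (πε/2)`, under `u ↦ u / √(1 - u²)` (`arcMeasure_eq_densityMeasure`).
Since it is symmetric, its potential at `x` is the integral of `-(1/2) log |u² - v²|`, which the
substitution `u = b cos α`, `v = b cos θ` reduces to integrals of `log |sin|`. Hence the potential
has the constant value `-log (b / 2)` on the whole arc (`integral_log_chordalSq`).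

*Energy gap.* Adding a small height `h` inside the logarithm gives a smaller, bounded kernel
`regKernel h`. For `h = (1 - r)² / (4 r)` its Fourier coefficients are `r ^ m / m`, so the energy
of a difference of probability measures is `∑ r ^ m / m * |D(m)|²`, where `D(m)` is the difference
of the `m`-th moments (`le_regEnergy_sub`). As `h → 0` the potentials of the arc measure increase
to the constant, uniformly by Dini's theorem. Therefore a probability measure on the arc with one
moment off by `δ` has energy above that of the arc measure by a margin depending only on `m` and
`δ`, already for some regularised kernel (`exists_regEnergy_gap`). Since the moments determine a
measure on the arc (Stone–Weierstrass), the arc measure is the unique minimiser.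

*Large deviations.* The regularised energy is finite on empirical measures and bounds the density
there, so the weight of configurations with the `m`-th moment off by `δ` is at most
`exp (-n² (c + κ) + O(n))`, where `c` is the minimal energy and `κ` the margin. Jensen's inequality
with respect to the product of arc measures shows that the partition function is at least `exp (-n² c - O(n))`
(`exists_le_weightMeasure_univ`). The quotient is summable in `n`, so by Borel–Cantelli, which
requires no independence between different `n`, all moments converge almost surely.
-/

namespace LogGas

open scoped ComplexConjugate

/-! ### The chordal distance and the regularised kernel -/

/-- A quarter of the squared chordal distance between the images of `x` and `y` on the unit circle
under the Cayley transform. -/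
noncomputable def chordalSq (x y : ℝ) : ℝ := (x - y) ^ 2 / ((1 + x ^ 2) * (1 + y ^ 2))

lemma chordalSq_nonneg (x y : ℝ) : 0 ≤ chordalSq x y := by unfold chordalSq; positivity

lemma chordalSq_le_one (x y : ℝ) : chordalSq x y ≤ 1 := by
  unfold chordalSq
  rw [div_le_one (by positivity)]
  nlinarith [sq_nonneg (1 + x * y)]

lemma chordalSq_self (x : ℝ) : chordalSq x x = 0 := by simp [chordalSq]

lemma chordalSq_comm (x y : ℝ) : chordalSq x y = chordalSq y x := by
  unfold chordalSq; rw [mul_comm (1 + x ^ 2)]; ring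

lemma chordalSq_pos {x y : ℝ} (h : x ≠ y) : 0 < chordalSq x y := by
  have := sub_ne_zero.2 h
  unfold chordalSq; positivity

lemma continuous_chordalSq : Continuous fun p : ℝ × ℝ => chordalSq p.1 p.2 := by
  unfold chordalSq
  exact Continuous.div (by fun_prop) (by fun_prop) fun p => by positivity

lemma log_chordalSq_nonpos (x y : ℝ) : Real.log (chordalSq x y) ≤ 0 :=
  Real.log_nonpos (chordalSq_nonneg x y) (chordalSq_le_one x y)

lemma log_chordalSq {x y : ℝ} (h : x ≠ y) : Real.log (chordalSq x y) =
    2 * Real.log |x - y| - Real.log (1 + x ^ 2) - Real.log (1 + y ^ 2) := by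
  have := sub_ne_zero.2 h
  unfold chordalSq
  rw [Real.log_div (by positivity) (by positivity), Real.log_mul (by positivity) (by positivity),
    Real.log_pow, Real.log_abs]
  push_cast; ring

/-- The Cayley transform, which maps `tan (θ / 2)` to `exp (iθ)`. -/
noncomputable def cayley (x : ℝ) : ℂ := (1 + x * Complex.I) / (1 - x * Complex.I)

lemma one_sub_mul_I_ne_zero (x : ℝ) : (1 - x * Complex.I : ℂ) ≠ 0 := fun h => by
  simpa using congrArg Complex.re h

lemma continuous_cayley : Continuous cayley := by
  unfold cayley
  exact Continuous.div (by fun_prop) (by fun_prop) one_sub_mul_I_ne_zero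

lemma cayley_eq (x : ℝ) :
    cayley x = ((1 - x ^ 2) / (1 + x ^ 2) : ℝ) + (2 * x / (1 + x ^ 2) : ℝ) * Complex.I := by
  have h : (1 + (x : ℂ) ^ 2) ≠ 0 := by
    have : (1 + x ^ 2 : ℝ) ≠ 0 := by positivity
    exact_mod_cast this
  unfold cayley
  rw [div_eq_iff (one_sub_mul_I_ne_zero x)]
  push_cast
  field_simp
  linear_combination (2 * (x : ℂ) ^ 2) * Complex.I_sq

lemma re_cayley (x : ℝ) : (cayley x).re = (1 - x ^ 2) / (1 + x ^ 2) := by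
  rw [cayley_eq]; simp [-Complex.ofReal_div]

lemma im_cayley (x : ℝ) : (cayley x).im = 2 * x / (1 + x ^ 2) := by
  rw [cayley_eq]; simp [-Complex.ofReal_div]

lemma norm_cayley (x : ℝ) : ‖cayley x‖ = 1 := by
  have h : (1 + x ^ 2 : ℝ) ≠ 0 := by positivity
  rw [← sq_eq_sq₀ (norm_nonneg _) zero_le_one, ← Complex.normSq_eq_norm_sq, Complex.normSq_apply,
    re_cayley, im_cayley]
  field_simp
  ring

lemma cayley_injective : Function.Injective cayley := by
  intro x y h
  have hre := congrArg Complex.re h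
  have him := congrArg Complex.im h
  rw [re_cayley, re_cayley] at hre
  rw [im_cayley, im_cayley] at him
  have h1 : (1 + x ^ 2 : ℝ) ≠ 0 := by positivity
  have h2 : (1 + y ^ 2 : ℝ) ≠ 0 := by positivity
  have e : ∀ t : ℝ, (1 - t ^ 2) / (1 + t ^ 2) + 1 = 2 / (1 + t ^ 2) := fun t => by
    have : (1 + t ^ 2 : ℝ) ≠ 0 := by positivity
    field_simp; ring
  have h3 : 2 / (1 + x ^ 2) = 2 / (1 + y ^ 2) := by rw [← e, ← e, hre]
  have h4 : x * (2 / (1 + x ^ 2)) = y * (2 / (1 + x ^ 2)) := by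
    calc x * (2 / (1 + x ^ 2)) = 2 * x / (1 + x ^ 2) := by ring
      _ = y * (2 / (1 + x ^ 2)) := by rw [him, h3]; ring
  exact mul_right_cancel₀ (by positivity) h4

lemma re_cayley_mul_conj (x y : ℝ) :
    (cayley x * conj (cayley y)).re = 1 - 2 * chordalSq x y := by
  have h1 : (1 + x ^ 2 : ℝ) ≠ 0 := by positivity
  have h2 : (1 + y ^ 2 : ℝ) ≠ 0 := by positivity
  simp only [Complex.mul_re, Complex.conj_re, Complex.conj_im, re_cayley, im_cayley, chordalSq]
  field_simp
  ring

/-- The logarithmic kernel `-log (|z - w| / 2)` in the chordal distance, with its singularity cut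
off at height `h`. -/
noncomputable def regKernel (h x y : ℝ) : ℝ := -(1 / 2) * Real.log (h + chordalSq x y)

lemma continuous_regKernel {h : ℝ} (hh : 0 < h) :
    Continuous fun p : ℝ × ℝ => regKernel h p.1 p.2 := by
  unfold regKernel
  refine continuous_const.mul (Continuous.log (continuous_const.add continuous_chordalSq) ?_)
  intro p
  have := chordalSq_nonneg p.1 p.2
  positivity

lemma regKernel_comm (h x y : ℝ) : regKernel h x y = regKernel h y x := by
  rw [regKernel, chordalSq_comm, regKernel]

lemma regKernel_le_log {h x y : ℝ} (hh : 0 < h) (hxy : x ≠ y) :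
    regKernel h x y ≤ -(1 / 2) * Real.log (chordalSq x y) := by
  have := Real.log_le_log (chordalSq_pos hxy) (by linarith : chordalSq x y ≤ h + chordalSq x y)
  unfold regKernel; linarith

lemma abs_regKernel_le {h : ℝ} (hh : 0 < h) (x y : ℝ) :
    |regKernel h x y| ≤ |Real.log h| + Real.log (h + 1) := by
  have h0 := chordalSq_nonneg x y
  have h1 := chordalSq_le_one x y
  have l1 := Real.log_le_log hh (by linarith : h ≤ h + chordalSq x y)
  have l2 := Real.log_le_log (by linarith) (by linarith : h + chordalSq x y ≤ h + 1)
  have l3 : 0 ≤ Real.log (h + 1) := Real.log_nonneg (by linarith)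
  have l4 := neg_abs_le (Real.log h)
  have l5 := abs_nonneg (Real.log h)
  unfold regKernel
  rw [abs_le]; constructor <;> linarith

lemma integrable_regKernel {h : ℝ} (hh : 0 < h) (μ : Measure (ℝ × ℝ)) [IsFiniteMeasure μ] :
    Integrable (fun p : ℝ × ℝ => regKernel h p.1 p.2) μ :=
  Integrable.of_bound (continuous_regKernel hh).aestronglyMeasurable _
    (Eventually.of_forall fun p => abs_regKernel_le hh p.1 p.2)

lemma integrable_regKernel_right {h : ℝ} (hh : 0 < h) (x : ℝ) (μ : Measure ℝ) [IsFiniteMeasure μ] :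
    Integrable (fun y => regKernel h x y) μ :=
  Integrable.of_bound
    ((continuous_regKernel hh).comp (Continuous.prodMk_right x)).aestronglyMeasurable _
    (Eventually.of_forall fun y => abs_regKernel_le hh x y)

/-- The cut-off height for which the regularised kernel has Fourier coefficients `r ^ m / m`. -/
noncomputable def cutoff (r : ℝ) : ℝ := (1 - r) ^ 2 / (4 * r)

lemma cutoff_pos {r : ℝ} (h0 : 0 < r) (h1 : r < 1) : 0 < cutoff r := by
  have : 0 < 1 - r := by linarith
  unfold cutoff; positivity

/-- The Fourier expansion of the regularised kernel: it is the Taylor series of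
`-log (1 - r z w̄)`. -/
lemma hasSum_regKernel {r : ℝ} (h0 : 0 < r) (h1 : r < 1) (x y : ℝ) :
    HasSum (fun m : ℕ => r ^ m / m * (cayley x ^ m * conj (cayley y ^ m)).re)
      (regKernel (cutoff r) x y - 1 / 2 * Real.log (4 * r)) := by
  set w : ℂ := cayley x * conj (cayley y) with hw
  have hwn : ‖w‖ = 1 := by simp [hw, norm_cayley]
  have hn : ‖(r : ℂ) * w‖ < 1 := by simpa [hwn, abs_of_pos h0] using h1
  have key := Complex.hasSum_re (Complex.hasSum_taylorSeries_neg_log hn)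
  have hsq : ‖1 - (r : ℂ) * w‖ ^ 2 = 4 * r * (cutoff r + chordalSq x y) := by
    have hre : w.re = 1 - 2 * chordalSq x y := re_cayley_mul_conj x y
    have hns : w.re * w.re + w.im * w.im = 1 := by
      rw [← Complex.normSq_apply, Complex.normSq_eq_norm_sq, hwn, one_pow]
    rw [← Complex.normSq_eq_norm_sq, Complex.normSq_apply]
    simp only [Complex.sub_re, Complex.sub_im, Complex.mul_re, Complex.mul_im, Complex.one_re,
      Complex.one_im, Complex.ofReal_re, Complex.ofReal_im]
    unfold cutoff
    field_simp
    linear_combination r ^ 2 * hns - 2 * r * hre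
  have hpos : 0 < cutoff r + chordalSq x y :=
    add_pos_of_pos_of_nonneg (cutoff_pos h0 h1) (chordalSq_nonneg x y)
  convert key using 1
  · ext m
    rw [mul_pow, mul_div_right_comm, hw, mul_pow, ← map_pow]
    rw [show ((r : ℂ) ^ m / m) = ((r ^ m / m : ℝ) : ℂ) by push_cast; rfl, Complex.re_ofReal_mul]
  · have hl := congrArg Real.log hsq
    rw [Real.log_pow, Real.log_mul (by positivity) hpos.ne'] at hl
    push_cast at hl
    rw [Complex.neg_re, Complex.log_re]
    unfold regKernel
    linarith

/-! ### Positive definiteness of the regularised kernel -/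

/-- The `m`-th trigonometric moment of a measure on the line, transported to the circle. -/
noncomputable def moment (μ : Measure ℝ) (m : ℕ) : ℂ := ∫ x, cayley x ^ m ∂μ

/-- The mutual energy of two measures for the regularised kernel. -/
noncomputable def regEnergy (h : ℝ) (μ ν : Measure ℝ) : ℝ :=
  ∫ p, regKernel h p.1 p.2 ∂(μ.prod ν)

lemma hasSum_regEnergy {r : ℝ} (h0 : 0 < r) (h1 : r < 1) (μ ν : Measure ℝ)
    [IsProbabilityMeasure μ] [IsProbabilityMeasure ν] :
    HasSum (fun m : ℕ => r ^ m / m * (moment μ m * conj (moment ν m)).re)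
      (regEnergy (cutoff r) μ ν - 1 / 2 * Real.log (4 * r)) := by
  set F : ℕ → ℝ × ℝ → ℝ := fun m p =>
    r ^ m / m * (cayley p.1 ^ m * conj (cayley p.2 ^ m)).re with hF
  have hcont : ∀ m : ℕ, Continuous fun p : ℝ × ℝ => cayley p.1 ^ m * conj (cayley p.2 ^ m) := by
    intro m
    have := continuous_cayley
    fun_prop
  have hbd : ∀ (m : ℕ) (p : ℝ × ℝ), ‖cayley p.1 ^ m * conj (cayley p.2 ^ m)‖ ≤ 1 := by
    intro m p; simp [norm_cayley]
  have hintC : ∀ m : ℕ, Integrable (fun p : ℝ × ℝ => cayley p.1 ^ m * conj (cayley p.2 ^ m))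
      (μ.prod ν) := fun m => Integrable.of_bound (hcont m).aestronglyMeasurable 1
        (Eventually.of_forall (hbd m))
  have hint : ∀ m, Integrable (F m) (μ.prod ν) := fun m => ((hintC m).re).const_mul _
  have hFb : ∀ m p, ‖F m p‖ ≤ r ^ m := by
    intro m p
    have h2 : |(cayley p.1 ^ m * conj (cayley p.2 ^ m)).re| ≤ 1 :=
      (Complex.abs_re_le_norm _).trans (hbd m p)
    have h3 : r ^ m / m ≤ r ^ m := by
      rcases Nat.eq_zero_or_pos m with rfl | hm
      · simp
      · exact div_le_self (by positivity) (by exact_mod_cast hm)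
    rw [hF, Real.norm_eq_abs, abs_mul, abs_of_nonneg (by positivity : 0 ≤ r ^ m / m)]
    calc _ ≤ r ^ m / m * 1 := by gcongr
      _ ≤ r ^ m := by simpa using h3
  have hsum : Summable fun m => ∫ p, ‖F m p‖ ∂(μ.prod ν) := by
    refine Summable.of_nonneg_of_le (fun m => integral_nonneg fun p => norm_nonneg _) (fun m => ?_)
      (summable_geometric_of_lt_one h0.le h1)
    calc ∫ p, ‖F m p‖ ∂(μ.prod ν) ≤ ∫ _, r ^ m ∂(μ.prod ν) :=
          integral_mono (hint m).norm (integrable_const _) (hFb m)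
      _ = r ^ m := by simp
  have key := hasSum_integral_of_summable_integral_norm hint hsum
  have e1 : ∀ m : ℕ, ∫ p, F m p ∂(μ.prod ν) =
      r ^ m / m * (moment μ m * conj (moment ν m)).re := by
    intro m
    have e2 : ∫ p, cayley p.1 ^ m * conj (cayley p.2 ^ m) ∂(μ.prod ν) =
        moment μ m * conj (moment ν m) := by
      rw [integral_prod_mul (fun x => cayley x ^ m) (fun y => conj (cayley y ^ m)), integral_conj]
      rfl
    rw [hF, integral_const_mul, ← e2]
    exact congrArg _ (integral_re (hintC m))
  have e3 : ∀ p : ℝ × ℝ, ∑' m, F m p =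
      regKernel (cutoff r) p.1 p.2 - 1 / 2 * Real.log (4 * r) := fun p =>
    (hasSum_regKernel h0 h1 p.1 p.2).tsum_eq
  have e4 : ∫ p : ℝ × ℝ, (regKernel (cutoff r) p.1 p.2 - 1 / 2 * Real.log (4 * r)) ∂(μ.prod ν) =
      regEnergy (cutoff r) μ ν - 1 / 2 * Real.log (4 * r) := by
    rw [integral_sub (integrable_regKernel (cutoff_pos h0 h1) _) (integrable_const _)]
    simp [regEnergy]
  simp only [e1, e3, e4] at key
  exact key

/-- The regularised energy of a difference of probability measures dominates each of its Fourier
modes. -/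
lemma le_regEnergy_sub {r : ℝ} (h0 : 0 < r) (h1 : r < 1) (μ ν : Measure ℝ)
    [IsProbabilityMeasure μ] [IsProbabilityMeasure ν] (m : ℕ) :
    r ^ m / m * ‖moment ν m - moment μ m‖ ^ 2 ≤
      regEnergy (cutoff r) ν ν - 2 * regEnergy (cutoff r) ν μ + regEnergy (cutoff r) μ μ := by
  have key := ((hasSum_regEnergy h0 h1 ν ν).sub ((hasSum_regEnergy h0 h1 ν μ).mul_left 2)).add
    (hasSum_regEnergy h0 h1 μ μ)
  have e : ∀ k : ℕ, r ^ k / k * (moment ν k * conj (moment ν k)).re -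
      2 * (r ^ k / k * (moment ν k * conj (moment μ k)).re) +
      r ^ k / k * (moment μ k * conj (moment μ k)).re =
      r ^ k / k * ‖moment ν k - moment μ k‖ ^ 2 := by
    intro k
    rw [← Complex.normSq_eq_norm_sq, Complex.normSq_apply]
    simp only [Complex.mul_re, Complex.conj_re, Complex.conj_im, Complex.sub_re, Complex.sub_im]
    ring
  simp only [e] at key
  have := le_hasSum key m fun k _ => by positivity
  linarith

/-! ### The arc measure as an image of the arcsine law -/

/-- The tangent of an angle in `(-π/2, π/2)` as a function of its sine. -/
noncomputable def tanOfSin (u : ℝ) : ℝ := u / √(1 - u ^ 2)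

/-- The sine of an angle in `(-π/2, π/2)` as a function of its tangent. -/
noncomputable def sinOfTan (x : ℝ) : ℝ := x / √(1 + x ^ 2)

lemma sinOfTan_sq (x : ℝ) : sinOfTan x ^ 2 = x ^ 2 / (1 + x ^ 2) := by
  rw [sinOfTan, div_pow, Real.sq_sqrt (by positivity)]

lemma tanOfSin_sinOfTan (x : ℝ) : tanOfSin (sinOfTan x) = x := by
  have h : (0 : ℝ) < 1 + x ^ 2 := by positivity
  have e : 1 - sinOfTan x ^ 2 = (1 + x ^ 2)⁻¹ := by
    rw [sinOfTan_sq]; field_simp; ring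
  rw [tanOfSin, e, Real.sqrt_inv, sinOfTan]
  have := Real.sqrt_pos.2 h
  field_simp

lemma one_add_tanOfSin_sq {u : ℝ} (hu : u ^ 2 < 1) : 1 + tanOfSin u ^ 2 = (1 - u ^ 2)⁻¹ := by
  have h : 0 < 1 - u ^ 2 := by linarith
  rw [tanOfSin, div_pow, Real.sq_sqrt h.le]; field_simp; ring

lemma sinOfTan_tanOfSin {u : ℝ} (hu : u ^ 2 < 1) : sinOfTan (tanOfSin u) = u := by
  have h : 0 < 1 - u ^ 2 := by linarith
  have := Real.sqrt_pos.2 h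
  rw [sinOfTan, one_add_tanOfSin_sq hu, Real.sqrt_inv, tanOfSin]
  field_simp

lemma sinOfTan_sq_le_sq {x y : ℝ} (h : x ^ 2 ≤ y ^ 2) : sinOfTan x ^ 2 ≤ sinOfTan y ^ 2 := by
  rw [sinOfTan_sq, sinOfTan_sq, div_le_div_iff₀ (by positivity) (by positivity)]
  nlinarith

lemma tanOfSin_sq {u : ℝ} (hu : u ^ 2 < 1) : tanOfSin u ^ 2 = u ^ 2 / (1 - u ^ 2) := by
  rw [tanOfSin, div_pow, Real.sq_sqrt (by linarith)]

lemma tanOfSin_sq_le_sq {u v : ℝ} (h : u ^ 2 ≤ v ^ 2) (hv : v ^ 2 < 1) :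
    tanOfSin u ^ 2 ≤ tanOfSin v ^ 2 := by
  rw [tanOfSin_sq (h.trans_lt hv), tanOfSin_sq hv,
    div_le_div_iff₀ (by linarith) (by linarith)]
  nlinarith

lemma tanOfSin_sq_lt_sq {u v : ℝ} (h : u ^ 2 < v ^ 2) (hv : v ^ 2 < 1) :
    tanOfSin u ^ 2 < tanOfSin v ^ 2 := by
  rw [tanOfSin_sq (h.trans hv), tanOfSin_sq hv,
    div_lt_div_iff₀ (by linarith) (by linarith)]
  nlinarith

lemma tanOfSin_nonneg {u : ℝ} (hu : 0 ≤ u) : 0 ≤ tanOfSin u := by unfold tanOfSin; positivity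

lemma tanOfSin_pos {u : ℝ} (h0 : 0 < u) (h1 : u < 1) : 0 < tanOfSin u := by
  have : 0 < 1 - u ^ 2 := by nlinarith
  have := Real.sqrt_pos.2 this
  unfold tanOfSin; positivity

lemma measurable_tanOfSin : Measurable tanOfSin := by unfold tanOfSin; fun_prop

lemma hasDerivAt_tanOfSin {u : ℝ} (hu : u ^ 2 < 1) :
    HasDerivAt tanOfSin ((1 - u ^ 2)⁻¹ * (√(1 - u ^ 2))⁻¹) u := by
  have h : 0 < 1 - u ^ 2 := by linarith
  have hs := Real.sqrt_pos.2 h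
  have h1 : HasDerivAt (fun u : ℝ => √(1 - u ^ 2)) (-(2 * u) / (2 * √(1 - u ^ 2))) u := by
    have := ((hasDerivAt_pow 2 u).const_sub 1).sqrt h.ne'
    simpa using this
  have h2 := (hasDerivAt_id u).div h1 hs.ne'
  refine h2.congr_deriv ?_
  have e := Real.sq_sqrt h.le
  simp only [id]
  rw [e]
  field_simp
  rw [e]; ring

lemma chordalSq_tanOfSin {u v : ℝ} (hu : u ^ 2 < 1) (hv : v ^ 2 < 1) :
    chordalSq (tanOfSin u) (tanOfSin v) = (u * √(1 - v ^ 2) - v * √(1 - u ^ 2)) ^ 2 := by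
  have h1 : 0 < 1 - u ^ 2 := by linarith
  have h2 : 0 < 1 - v ^ 2 := by linarith
  have h3 := Real.sqrt_pos.2 h1
  have h4 := Real.sqrt_pos.2 h2
  rw [chordalSq, one_add_tanOfSin_sq hu, one_add_tanOfSin_sq hv, tanOfSin, tanOfSin,
    div_sub_div _ _ h3.ne' h4.ne', div_pow, mul_pow, Real.sq_sqrt h1.le, Real.sq_sqrt h2.le]
  field_simp

/-- Multiplying the chordal distances to `v` and to `-v` gives `u² - v²`, in which the square roots
have disappeared. -/
lemma chordalSq_mul_chordalSq_neg {u v : ℝ} (hu : u ^ 2 < 1) (hv : v ^ 2 < 1) :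
    chordalSq (tanOfSin u) (tanOfSin v) * chordalSq (tanOfSin u) (tanOfSin (-v)) =
      (u ^ 2 - v ^ 2) ^ 2 := by
  rw [chordalSq_tanOfSin hu hv, chordalSq_tanOfSin hu (by rwa [neg_sq]), neg_sq]
  have e1 := Real.sq_sqrt (show 0 ≤ 1 - u ^ 2 by linarith)
  have e2 := Real.sq_sqrt (show 0 ≤ 1 - v ^ 2 by linarith)
  rw [← mul_pow]
  congr 1
  linear_combination u ^ 2 * e2 - v ^ 2 * e1

lemma mul_cos_sq_lt_one {b : ℝ} (h0 : 0 < b) (h1 : b < 1) (θ : ℝ) :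
    (b * Real.cos θ) ^ 2 < 1 := by
  have := Real.cos_sq_le_one θ
  nlinarith [mul_pow b (Real.cos θ) 2]

/-- The uniform probability measure on `(0, π)`. -/
noncomputable def uniformAngle : Measure ℝ :=
  ENNReal.ofReal Real.pi⁻¹ • volume.restrict (Ioo 0 Real.pi)

instance : IsProbabilityMeasure uniformAngle := by
  constructor
  rw [uniformAngle, Measure.smul_apply, Measure.restrict_apply_univ, Real.volume_Ioo, smul_eq_mul,
    sub_zero, ← ENNReal.ofReal_mul (by positivity), inv_mul_cancel₀ Real.pi_ne_zero,
    ENNReal.ofReal_one]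

lemma integral_uniformAngle (g : ℝ → ℝ) :
    ∫ θ, g θ ∂uniformAngle = Real.pi⁻¹ * ∫ θ in 0..Real.pi, g θ := by
  rw [uniformAngle, integral_smul_measure, intervalIntegral.integral_of_le Real.pi_pos.le,
    integral_Ioc_eq_integral_Ioo, ENNReal.toReal_ofReal (by positivity), smul_eq_mul]

lemma integrable_uniformAngle {g : ℝ → ℝ} (hg : IntervalIntegrable g volume 0 Real.pi) :
    Integrable g uniformAngle := by
  refine Integrable.smul_measure ?_ ENNReal.ofReal_ne_top
  rw [intervalIntegrable_iff_integrableOn_Ioo_of_le Real.pi_pos.le] at hg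
  exact hg

/-- The image of the arcsine law on `[-b, b]` under `u ↦ u / √(1 - u²)`. -/
noncomputable def arcMeasure (b : ℝ) : Measure ℝ :=
  uniformAngle.map fun θ => tanOfSin (b * Real.cos θ)

lemma measurable_arcPoint (b : ℝ) : Measurable fun θ => tanOfSin (b * Real.cos θ) :=
  measurable_tanOfSin.comp (by fun_prop)

instance (b : ℝ) : IsProbabilityMeasure (arcMeasure b) :=
  Measure.isProbabilityMeasure_map (measurable_arcPoint b).aemeasurable

lemma arcMeasure_compl_Icc {b : ℝ} (h0 : 0 < b) (h1 : b < 1) :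
    arcMeasure b (Icc (-tanOfSin b) (tanOfSin b))ᶜ = 0 := by
  rw [arcMeasure, Measure.map_apply (measurable_arcPoint b) measurableSet_Icc.compl]
  convert measure_empty (μ := uniformAngle)
  refine eq_empty_of_forall_notMem fun θ hθ => hθ ?_
  have : (b * Real.cos θ) ^ 2 ≤ b ^ 2 := by
    have := Real.cos_sq_le_one θ
    nlinarith [mul_pow b (Real.cos θ) 2]
  exact abs_le.1 (abs_le_of_sq_le_sq (tanOfSin_sq_le_sq this (by nlinarith))
    (tanOfSin_nonneg h0.le))

/-! ### The logarithmic potential of the arc measure -/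

lemma log_comp_sin_periodic : Function.Periodic (Real.log ∘ Real.sin) Real.pi := fun θ => by
  simp [Real.sin_add_pi, Real.log_neg_eq_log]

lemma intervalIntegrable_log_sin_add (α : ℝ) :
    IntervalIntegrable (fun θ => Real.log (Real.sin (θ + α))) volume 0 Real.pi := by
  have := (intervalIntegrable_log_sin (a := 0 + α) (b := Real.pi + α)).comp_add_right α
  simpa using this

lemma integral_log_sin_add (α : ℝ) :
    ∫ θ in 0..Real.pi, Real.log (Real.sin (θ + α)) = -Real.log 2 * Real.pi := by
  have h := intervalIntegral.integral_comp_add_right (a := 0) (b := Real.pi)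
    (Real.log ∘ Real.sin) α
  simp only [Function.comp_apply] at h
  have h2 := log_comp_sin_periodic.intervalIntegral_add_eq α 0
  rw [h, zero_add, add_comm Real.pi α]
  rw [zero_add] at h2
  exact h2.trans integral_log_sin_zero_pi

lemma log_chordalSq_arcPoint_add {b : ℝ} (h0 : 0 < b) (h1 : b < 1) {α θ : ℝ}
    (hα : α ∈ Icc 0 Real.pi) (hθ : θ ∈ Ioo 0 Real.pi) (hne : θ ≠ α) (hne' : θ ≠ Real.pi - α) :
    Real.log (chordalSq (tanOfSin (b * Real.cos α)) (tanOfSin (b * Real.cos θ))) +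
      Real.log (chordalSq (tanOfSin (b * Real.cos α)) (tanOfSin (b * Real.cos (Real.pi - θ)))) =
    4 * Real.log b + 2 * Real.log (Real.sin (θ + α)) + 2 * Real.log (Real.sin (θ + -α)) := by
  have hs : Real.sin (θ + α) * Real.sin (θ + -α) = Real.cos α ^ 2 - Real.cos θ ^ 2 := by
    rw [Real.sin_add, Real.sin_add, Real.cos_neg, Real.sin_neg]
    have e1 := Real.sin_sq_add_cos_sq θ
    have e2 := Real.sin_sq_add_cos_sq α
    linear_combination Real.cos α ^ 2 * e1 - Real.cos θ ^ 2 * e2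
  have hc1 : Real.cos θ ≠ Real.cos α := fun h =>
    hne (Real.injOn_cos ⟨hθ.1.le, hθ.2.le⟩ hα h)
  have hc2 : Real.cos θ ≠ -Real.cos α := fun h => by
    rw [← Real.cos_pi_sub] at h
    exact hne' (Real.injOn_cos ⟨hθ.1.le, hθ.2.le⟩
      ⟨by linarith [hα.2], by linarith [hα.1]⟩ h)
  have hd : Real.cos α ^ 2 - Real.cos θ ^ 2 ≠ 0 := by
    rw [sq_sub_sq]
    refine mul_ne_zero (fun h => hc2 (by linarith)) (fun h => hc1 (by linarith))
  have hs1 : Real.sin (θ + α) ≠ 0 := left_ne_zero_of_mul (hs ▸ hd)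
  have hs2 : Real.sin (θ + -α) ≠ 0 := right_ne_zero_of_mul (hs ▸ hd)
  have hprod : chordalSq (tanOfSin (b * Real.cos α)) (tanOfSin (b * Real.cos θ)) *
      chordalSq (tanOfSin (b * Real.cos α)) (tanOfSin (b * Real.cos (Real.pi - θ))) =
      (b ^ 2 * (Real.sin (θ + α) * Real.sin (θ + -α))) ^ 2 := by
    rw [Real.cos_pi_sub, mul_neg, chordalSq_mul_chordalSq_neg (mul_cos_sq_lt_one h0 h1 _)
      (mul_cos_sq_lt_one h0 h1 _), hs]
    ring
  have hne0 : (b ^ 2 * (Real.sin (θ + α) * Real.sin (θ + -α))) ^ 2 ≠ 0 := by positivity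
  rw [← Real.log_mul (left_ne_zero_of_mul (hprod ▸ hne0)) (right_ne_zero_of_mul (hprod ▸ hne0)),
    hprod, Real.log_pow, Real.log_mul (by positivity) (mul_ne_zero hs1 hs2),
    Real.log_mul hs1 hs2, Real.log_pow]
  push_cast; ring

lemma measurable_log_chordalSq (x : ℝ) : Measurable fun y => Real.log (chordalSq x y) :=
  Real.measurable_log.comp (continuous_chordalSq.comp (Continuous.prodMk_right x)).measurable

lemma exists_angle {b : ℝ} (h0 : 0 < b) (h1 : b < 1) {x : ℝ}
    (hx : x ∈ Icc (-tanOfSin b) (tanOfSin b)) :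
    ∃ α ∈ Icc 0 Real.pi, tanOfSin (b * Real.cos α) = x := by
  have h2 : x ^ 2 ≤ tanOfSin b ^ 2 := sq_le_sq' hx.1 hx.2
  have h3 := sinOfTan_sq_le_sq h2
  rw [sinOfTan_tanOfSin (by nlinarith)] at h3
  obtain ⟨h4, h5⟩ := abs_le.1 (abs_le_of_sq_le_sq h3 h0.le)
  refine ⟨Real.arccos (sinOfTan x / b), ⟨Real.arccos_nonneg _, Real.arccos_le_pi _⟩, ?_⟩
  rw [Real.cos_arccos (by rw [le_div_iff₀ h0]; linarith) (by rw [div_le_iff₀ h0]; linarith),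
    mul_div_cancel₀ _ h0.ne', tanOfSin_sinOfTan]

/-- The potential of the arc measure is constant on the arc: after the symmetrisation `θ ↦ π - θ`
the integrand is `log |sin (θ + α) sin (θ - α)|` up to a constant. -/
lemma intervalIntegral_log_chordalSq {b : ℝ} (h0 : 0 < b) (h1 : b < 1) {x : ℝ}
    (hx : x ∈ Icc (-tanOfSin b) (tanOfSin b)) :
    IntervalIntegrable (fun θ => Real.log (chordalSq x (tanOfSin (b * Real.cos θ)))) volume
        0 Real.pi ∧
      ∫ θ in 0..Real.pi, Real.log (chordalSq x (tanOfSin (b * Real.cos θ))) =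
        2 * Real.pi * Real.log (b / 2) := by
  obtain ⟨α, hα, rfl⟩ := exists_angle h0 h1 hx
  set g : ℝ → ℝ := fun θ =>
    Real.log (chordalSq (tanOfSin (b * Real.cos α)) (tanOfSin (b * Real.cos θ))) with hg
  set G : ℝ → ℝ := fun θ => 4 * Real.log b + 2 * Real.log (Real.sin (θ + α)) +
    2 * Real.log (Real.sin (θ + -α)) with hG
  have hGi : IntervalIntegrable G volume 0 Real.pi :=
    (intervalIntegrable_const.add ((intervalIntegrable_log_sin_add α).const_mul 2)).add
      ((intervalIntegrable_log_sin_add (-α)).const_mul 2)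
  have hae : ∀ᵐ θ, θ ∈ uIoc 0 Real.pi → g θ + g (Real.pi - θ) = G θ := by
    have h2 : ∀ y : ℝ, ∀ᵐ θ : ℝ, θ ≠ y := fun y => by simp [ae_iff]
    filter_upwards [h2 α, h2 (Real.pi - α), h2 Real.pi] with θ e1 e2 e3 hθ
    rw [uIoc_of_le Real.pi_pos.le] at hθ
    exact log_chordalSq_arcPoint_add h0 h1 hα ⟨hθ.1, lt_of_le_of_ne hθ.2 e3⟩ e1 e2
  have hgm : Measurable g := (measurable_log_chordalSq _).comp (measurable_arcPoint b)
  have hgi : IntervalIntegrable g volume 0 Real.pi := by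
    refine hGi.mono_fun hgm.aestronglyMeasurable ?_
    rw [EventuallyLE, ae_restrict_iff' measurableSet_uIoc]
    filter_upwards [hae] with θ hθ hθ'
    rw [← hθ hθ', Real.norm_eq_abs, Real.norm_eq_abs]
    have e1 : g θ ≤ 0 := log_chordalSq_nonpos _ _
    have e2 : g (Real.pi - θ) ≤ 0 := log_chordalSq_nonpos _ _
    rw [abs_of_nonpos e1, abs_of_nonpos (by linarith)]
    linarith
  refine ⟨hgi, ?_⟩
  have hgi' : IntervalIntegrable (fun θ => g (Real.pi - θ)) volume 0 Real.pi := by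
    have := hgi.comp_sub_left Real.pi
    simp only [sub_zero, sub_self] at this
    exact this.symm
  have e1 : ∫ θ in 0..Real.pi, g (Real.pi - θ) = ∫ θ in 0..Real.pi, g θ := by
    rw [intervalIntegral.integral_comp_sub_left]; simp
  have e2 : ∫ θ in 0..Real.pi, (g θ + g (Real.pi - θ)) = ∫ θ in 0..Real.pi, G θ :=
    intervalIntegral.integral_congr_ae hae
  rw [intervalIntegral.integral_add hgi hgi', e1, hG, intervalIntegral.integral_add
    (intervalIntegrable_const.add ((intervalIntegrable_log_sin_add α).const_mul 2))
      ((intervalIntegrable_log_sin_add (-α)).const_mul 2),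
    intervalIntegral.integral_add intervalIntegrable_const
      ((intervalIntegrable_log_sin_add α).const_mul 2),
    intervalIntegral.integral_const_mul 2, intervalIntegral.integral_const_mul 2,
    integral_log_sin_add, integral_log_sin_add, intervalIntegral.integral_const, smul_eq_mul] at e2
  rw [Real.log_div h0.ne' two_ne_zero]
  linarith

lemma integrable_log_chordalSq {b : ℝ} (h0 : 0 < b) (h1 : b < 1) {x : ℝ}
    (hx : x ∈ Icc (-tanOfSin b) (tanOfSin b)) :
    Integrable (fun y => Real.log (chordalSq x y)) (arcMeasure b) :=
  (integrable_map_measure (measurable_log_chordalSq x).aestronglyMeasurable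
    (measurable_arcPoint b).aemeasurable).2
      (integrable_uniformAngle (intervalIntegral_log_chordalSq h0 h1 hx).1)

/-- The Euler–Lagrange equation of the arc measure. -/
lemma integral_log_chordalSq {b : ℝ} (h0 : 0 < b) (h1 : b < 1) {x : ℝ}
    (hx : x ∈ Icc (-tanOfSin b) (tanOfSin b)) :
    ∫ y, Real.log (chordalSq x y) ∂(arcMeasure b) = 2 * Real.log (b / 2) := by
  rw [arcMeasure, integral_map (measurable_arcPoint b).aemeasurable
    (measurable_log_chordalSq x).aestronglyMeasurable, integral_uniformAngle,
    (intervalIntegral_log_chordalSq h0 h1 hx).2]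
  field_simp

/-! ### The density of the arc measure -/

lemma image_arcPoint {b : ℝ} (h0 : 0 < b) (h1 : b < 1) :
    (fun θ => tanOfSin (b * Real.cos θ)) '' Ioo 0 Real.pi = Ioo (-tanOfSin b) (tanOfSin b) := by
  have hb : b ^ 2 < 1 := by nlinarith
  have ht := tanOfSin_pos h0 h1
  ext x
  constructor
  · rintro ⟨θ, hθ, rfl⟩
    refine abs_lt.1 (abs_lt_of_sq_lt_sq (tanOfSin_sq_lt_sq ?_ hb) ht.le)
    have h2 := Real.sin_pos_of_mem_Ioo hθ
    have h3 := Real.sin_sq_add_cos_sq θ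
    have : Real.cos θ ^ 2 < 1 := by nlinarith
    rw [mul_pow]
    nlinarith [pow_pos h0 2]
  · intro hx
    obtain ⟨α, hα, rfl⟩ := exists_angle h0 h1 (Ioo_subset_Icc_self hx)
    refine ⟨α, ⟨lt_of_le_of_ne hα.1 ?_, lt_of_le_of_ne hα.2 ?_⟩, rfl⟩
    · rintro rfl
      simp at hx
    · rintro rfl
      have : tanOfSin (-b) = -tanOfSin b := by simp [tanOfSin, neg_div]
      simp [this] at hx

lemma injOn_arcPoint {b : ℝ} (h0 : 0 < b) (h1 : b < 1) :
    InjOn (fun θ => tanOfSin (b * Real.cos θ)) (Ioo 0 Real.pi) := by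
  intro θ hθ η hη h
  have h2 := congrArg sinOfTan h
  simp only [sinOfTan_tanOfSin (mul_cos_sq_lt_one h0 h1 _)] at h2
  exact Real.injOn_cos (Ioo_subset_Icc_self hθ) (Ioo_subset_Icc_self hη)
    (mul_left_cancel₀ h0.ne' h2)

/-- The density of the arc measure in terms of the sine `b` of the half-angle. -/
noncomputable def arcDensityAux (b x : ℝ) : ℝ :=
  1 / (Real.pi * √(1 - b ^ 2) * (1 + x ^ 2) * √(tanOfSin b ^ 2 - x ^ 2))

lemma arcDensityAux_arcPoint {b : ℝ} (h0 : 0 < b) (h1 : b < 1) {θ : ℝ}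
    (hθ : θ ∈ Ioo 0 Real.pi) :
    |(1 - (b * Real.cos θ) ^ 2)⁻¹ * (√(1 - (b * Real.cos θ) ^ 2))⁻¹ * (b * -Real.sin θ)| *
      arcDensityAux b (tanOfSin (b * Real.cos θ)) = Real.pi⁻¹ := by
  have hs := Real.sin_pos_of_mem_Ioo hθ
  have hb : b ^ 2 < 1 := by nlinarith
  have hb' : 0 < 1 - b ^ 2 := by linarith
  have hu := mul_cos_sq_lt_one h0 h1 θ
  have hu' : 0 < 1 - (b * Real.cos θ) ^ 2 := by linarith
  have hq := Real.sqrt_pos.2 hb'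
  have hw := Real.sqrt_pos.2 hu'
  have e : √(tanOfSin b ^ 2 - tanOfSin (b * Real.cos θ) ^ 2) =
      b * Real.sin θ / (√(1 - b ^ 2) * √(1 - (b * Real.cos θ) ^ 2)) := by
    rw [← Real.sqrt_sq (show 0 ≤ b * Real.sin θ / (√(1 - b ^ 2) * √(1 - (b * Real.cos θ) ^ 2))
      by positivity)]
    congr 1
    rw [tanOfSin_sq hb, tanOfSin_sq hu, div_pow, mul_pow √(1 - b ^ 2), Real.sq_sqrt hb'.le,
      Real.sq_sqrt hu'.le, div_sub_div _ _ hb'.ne' hu'.ne']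
    congr 1
    have := Real.sin_sq_add_cos_sq θ
    linear_combination (-b ^ 2) * this
  rw [arcDensityAux, e, one_add_tanOfSin_sq hu, mul_neg, mul_neg, abs_neg, abs_of_nonneg
    (by positivity)]
  generalize √(1 - (b * Real.cos θ) ^ 2) = w at hw ⊢
  generalize 1 - (b * Real.cos θ) ^ 2 = D at hu' ⊢
  field_simp

lemma arcMeasure_eq_densityMeasure {b : ℝ} (h0 : 0 < b) (h1 : b < 1) :
    densityMeasure ((Icc (-tanOfSin b) (tanOfSin b)).indicator (arcDensityAux b)) =
      arcMeasure b := by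
  ext s hs
  rw [arcMeasure, Measure.map_apply (measurable_arcPoint b) hs, densityMeasure,
    withDensity_apply _ hs, uniformAngle, Measure.smul_apply,
    Measure.restrict_apply ((measurable_arcPoint b) hs), smul_eq_mul]
  have e1 : ∫⁻ x in s, ENNReal.ofReal
      ((Icc (-tanOfSin b) (tanOfSin b)).indicator (arcDensityAux b) x) =
      ∫⁻ x in Ioo (-tanOfSin b) (tanOfSin b),
        s.indicator (fun x => ENNReal.ofReal (arcDensityAux b x)) x := by
    rw [setLIntegral_congr Ioo_ae_eq_Icc, ← lintegral_indicator hs,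
      ← lintegral_indicator measurableSet_Icc]
    congr 1
    ext x
    by_cases h1 : x ∈ s <;> by_cases h2 : x ∈ Icc (-tanOfSin b) (tanOfSin b) <;>
      simp [indicator, h1, h2, -mem_Icc]
  rw [e1, ← image_arcPoint h0 h1, lintegral_image_eq_lintegral_abs_deriv_mul measurableSet_Ioo
    (f' := fun θ => (1 - (b * Real.cos θ) ^ 2)⁻¹ * (√(1 - (b * Real.cos θ) ^ 2))⁻¹ *
      (b * -Real.sin θ))
    (fun θ _ => ?_) (injOn_arcPoint h0 h1)]
  · have e2 : ∀ θ ∈ Ioo 0 Real.pi,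
        ENNReal.ofReal |(1 - (b * Real.cos θ) ^ 2)⁻¹ * (√(1 - (b * Real.cos θ) ^ 2))⁻¹ *
          (b * -Real.sin θ)| *
          s.indicator (fun x => ENNReal.ofReal (arcDensityAux b x)) (tanOfSin (b * Real.cos θ)) =
        ((fun θ => tanOfSin (b * Real.cos θ)) ⁻¹' s).indicator
          (fun _ => ENNReal.ofReal Real.pi⁻¹) θ := by
      intro θ hθ
      by_cases h : tanOfSin (b * Real.cos θ) ∈ s
      · rw [indicator_of_mem h, indicator_of_mem (by exact h),
          ← ENNReal.ofReal_mul (abs_nonneg _), arcDensityAux_arcPoint h0 h1 hθ]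
      · rw [indicator_of_notMem h, indicator_of_notMem (by exact h), mul_zero]
    rw [setLIntegral_congr_fun measurableSet_Ioo e2,
      lintegral_indicator ((measurable_arcPoint b) hs), lintegral_const,
      Measure.restrict_restrict ((measurable_arcPoint b) hs), Measure.restrict_apply_univ]
  · refine HasDerivAt.hasDerivWithinAt ?_
    exact (hasDerivAt_tanOfSin (mul_cos_sq_lt_one h0 h1 θ)).comp θ
      ((Real.hasDerivAt_cos θ).const_mul b)

lemma arcMeasure_absolutelyContinuous {b : ℝ} (h0 : 0 < b) (h1 : b < 1) :
    arcMeasure b ≪ volume := by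
  rw [← arcMeasure_eq_densityMeasure h0 h1]
  exact withDensity_absolutelyContinuous _ _

lemma nullSingletonClass_arcMeasure {b : ℝ} (h0 : 0 < b) (h1 : b < 1) :
    NullSingletonClass (arcMeasure b) :=
  ⟨fun x => arcMeasure_absolutelyContinuous h0 h1 (measure_singleton x)⟩

/-! ### The regularised potential of the arc measure and the energy gap -/

/-- The constant value of the potential of the arc measure on the arc. -/
noncomputable def robinConstant (b : ℝ) : ℝ := -Real.log (b / 2)

/-- Radii increasing to `1`. -/
noncomputable def radius (n : ℕ) : ℝ := (n + 1) / (n + 2)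

lemma radius_pos (n : ℕ) : 0 < radius n := by unfold radius; positivity

lemma radius_lt_one (n : ℕ) : radius n < 1 := by
  unfold radius
  rw [div_lt_one (by positivity)]; linarith

lemma tendsto_radius : Tendsto radius atTop (𝓝 1) := by
  have h : ∀ n : ℕ, radius n = 1 - 1 / ((n + 1 : ℕ) + 1 : ℝ) := fun n => by
    unfold radius; push_cast; field_simp; ring
  rw [show radius = _ from funext h]
  simpa using ((tendsto_add_atTop_iff_nat 1).2
    (tendsto_one_div_add_atTop_nhds_zero_nat (𝕜 := ℝ))).const_sub 1

lemma cutoff_radius (n : ℕ) : cutoff (radius n) = 1 / (4 * (n + 1) * (n + 2)) := by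
  unfold cutoff radius; field_simp; ring

lemma antitone_cutoff_radius : Antitone fun n => cutoff (radius n) := by
  intro m n h
  have : (m : ℝ) ≤ n := by exact_mod_cast h
  simp only [cutoff_radius]
  gcongr

lemma tendsto_cutoff_radius : Tendsto (fun n => cutoff (radius n)) atTop (𝓝 0) := by
  have h : Tendsto (fun r : ℝ => cutoff r) (𝓝 1) (𝓝 (cutoff 1)) := by
    unfold cutoff
    exact ContinuousAt.div (by fun_prop) (by fun_prop) (by norm_num)
  have h' := h.comp tendsto_radius
  rwa [show cutoff 1 = 0 by simp [cutoff]] at h'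

lemma regKernel_anti {h h' : ℝ} (hh : 0 < h) (hle : h ≤ h') (x y : ℝ) :
    regKernel h' x y ≤ regKernel h x y := by
  have h0 := chordalSq_nonneg x y
  have := Real.log_le_log (by linarith) (by linarith : h + chordalSq x y ≤ h' + chordalSq x y)
  unfold regKernel; linarith

/-- The potential of a measure for the regularised kernel. -/
noncomputable def regPotential (h : ℝ) (μ : Measure ℝ) (x : ℝ) : ℝ := ∫ y, regKernel h x y ∂μ

lemma continuous_regPotential {h : ℝ} (hh : 0 < h) (μ : Measure ℝ) [IsFiniteMeasure μ] :
    Continuous (regPotential h μ) :=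
  continuous_of_dominated
    (fun x => (integrable_regKernel_right hh x μ).aestronglyMeasurable)
    (fun x => Eventually.of_forall fun y => abs_regKernel_le hh x y) (integrable_const _)
    (Eventually.of_forall fun y => (continuous_regKernel hh).comp (Continuous.prodMk_left y))

lemma regEnergy_eq {h : ℝ} (hh : 0 < h) (ν μ : Measure ℝ) [IsFiniteMeasure μ] [IsFiniteMeasure ν] :
    regEnergy h ν μ = ∫ x, regPotential h μ x ∂ν :=
  integral_prod _ (integrable_regKernel hh _)

lemma integrable_regPotential {h : ℝ} (hh : 0 < h) (ν μ : Measure ℝ) [IsFiniteMeasure μ]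
    [IsFiniteMeasure ν] : Integrable (regPotential h μ) ν :=
  (integrable_regKernel hh (ν.prod μ)).integral_prod_left

/-- The regularised potentials of the arc measure converge on the arc; the singular potential,
integrable by the Euler–Lagrange computation, dominates them. -/
lemma tendsto_regPotential {b : ℝ} (h0 : 0 < b) (h1 : b < 1) {x : ℝ}
    (hx : x ∈ Icc (-tanOfSin b) (tanOfSin b)) :
    Tendsto (fun n => regPotential (cutoff (radius n)) (arcMeasure b) x) atTop
      (𝓝 (robinConstant b)) := by
  have := nullSingletonClass_arcMeasure h0 h1
  have hne : ∀ᵐ y ∂(arcMeasure b), y ≠ x := by simp [ae_iff]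
  have hlim : robinConstant b = ∫ y, -(1 / 2) * Real.log (chordalSq x y) ∂(arcMeasure b) := by
    rw [integral_const_mul, integral_log_chordalSq h0 h1 hx, robinConstant]; ring
  have hpos := fun n => cutoff_pos (radius_pos n) (radius_lt_one n)
  rw [hlim]
  refine tendsto_integral_of_dominated_convergence
    (fun y => |Real.log (chordalSq x y)| + |Real.log (cutoff (radius 0) + 1)|) ?_ ?_ ?_ ?_
  · exact fun n => (integrable_regKernel_right (hpos n) x _).aestronglyMeasurable
  · exact (integrable_log_chordalSq h0 h1 hx).abs.add (integrable_const _)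
  · intro n
    filter_upwards [hne] with y hy
    have e1 := regKernel_le_log (hpos n) hy.symm
    have e2 := regKernel_anti (hpos n) (antitone_cutoff_radius (Nat.zero_le n)) x y
    have e3 := Real.log_le_log (add_pos_of_pos_of_nonneg (hpos 0) (chordalSq_nonneg x y))
      (by linarith [chordalSq_le_one x y] : cutoff (radius 0) + chordalSq x y ≤
        cutoff (radius 0) + 1)
    have e4 := log_chordalSq_nonpos x y
    have e5 := le_abs_self (Real.log (cutoff (radius 0) + 1))
    have e6 := abs_nonneg (Real.log (cutoff (radius 0) + 1))
    have e7 : regKernel (cutoff (radius 0)) x y =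
      -(1 / 2) * Real.log (cutoff (radius 0) + chordalSq x y) := rfl
    rw [Real.norm_eq_abs, abs_of_nonpos e4, abs_le]
    constructor <;> linarith
  · filter_upwards [hne] with y hy
    have hp := chordalSq_pos hy.symm
    have : Tendsto (fun n => cutoff (radius n) + chordalSq x y) atTop (𝓝 (chordalSq x y)) := by
      simpa using tendsto_cutoff_radius.add_const (chordalSq x y)
    exact (this.log hp.ne').const_mul _

lemma regPotential_le {b h : ℝ} (h0 : 0 < b) (h1 : b < 1) (hh : 0 < h) {x : ℝ}
    (hx : x ∈ Icc (-tanOfSin b) (tanOfSin b)) :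
    regPotential h (arcMeasure b) x ≤ robinConstant b := by
  have := nullSingletonClass_arcMeasure h0 h1
  have hne : ∀ᵐ y ∂(arcMeasure b), y ≠ x := by simp [ae_iff]
  have hlim : robinConstant b = ∫ y, -(1 / 2) * Real.log (chordalSq x y) ∂(arcMeasure b) := by
    rw [integral_const_mul, integral_log_chordalSq h0 h1 hx, robinConstant]; ring
  rw [hlim]
  refine integral_mono_ae (integrable_regKernel_right hh x _)
    ((integrable_log_chordalSq h0 h1 hx).const_mul _) ?_
  filter_upwards [hne] with y hy using regKernel_le_log hh hy.symm

/-- By Dini's theorem the convergence of the regularised potentials is uniform on the arc. -/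
lemma tendstoUniformlyOn_regPotential {b : ℝ} (h0 : 0 < b) (h1 : b < 1) :
    TendstoUniformlyOn (fun n => regPotential (cutoff (radius n)) (arcMeasure b))
      (fun _ => robinConstant b) atTop (Icc (-tanOfSin b) (tanOfSin b)) := by
  have hpos := fun n => cutoff_pos (radius_pos n) (radius_lt_one n)
  refine Monotone.tendstoUniformlyOn_of_forall_tendsto isCompact_Icc
    (fun n => (continuous_regPotential (hpos n) _).continuousOn) ?_ continuousOn_const
    (fun x hx => tendsto_regPotential h0 h1 hx)
  intro x _ m n hmn
  exact integral_mono (integrable_regKernel_right (hpos m) x _)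
    (integrable_regKernel_right (hpos n) x _)
    fun y => regKernel_anti (hpos n) (antitone_cutoff_radius hmn) x y

lemma ae_mem_of_compl_null {ν : Measure ℝ} {s : Set ℝ} (h : ν sᶜ = 0) : ∀ᵐ x ∂ν, x ∈ s := h

/-- A probability measure on the arc whose `m`-th moment is at distance `δ` from that of the arc
measure has a larger energy, by a margin that depends on `m` and `δ` only. The margin is attained
already by a regularised energy, which makes sense for measures with atoms. -/
lemma exists_regEnergy_gap {b : ℝ} (h0 : 0 < b) (h1 : b < 1) {m : ℕ} (hm : 1 ≤ m) {δ : ℝ}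
    (hδ : 0 < δ) : ∃ h > 0, ∃ κ > 0, ∀ ν : Measure ℝ, IsProbabilityMeasure ν →
      ν (Icc (-tanOfSin b) (tanOfSin b))ᶜ = 0 →
      δ ≤ ‖moment ν m - moment (arcMeasure b) m‖ → robinConstant b + κ ≤ regEnergy h ν ν := by
  have hm' : (0 : ℝ) < m := by exact_mod_cast hm
  -- Once `r ^ m ≥ 1 / 2`, the `m`-th mode contributes at least `4 η`; replacing the regularised
  -- potential of the arc measure by its limit costs at most `2 η`.
  set η : ℝ := δ ^ 2 / (8 * m) with hη
  have hη0 : 0 < η := by positivity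
  have hr : ∀ᶠ n in atTop, 1 / 2 < radius n ^ m := by
    have : Tendsto (fun n => radius n ^ m) atTop (𝓝 1) := by simpa using tendsto_radius.pow m
    exact this.eventually_const_lt (by norm_num)
  obtain ⟨n, hn1, hn2⟩ :=
    (hr.and (Metric.tendstoUniformlyOn_iff.1 (tendstoUniformlyOn_regPotential h0 h1) η hη0)).exists
  have hpos := cutoff_pos (radius_pos n) (radius_lt_one n)
  refine ⟨cutoff (radius n), hpos, 2 * η, by positivity, fun ν hν hν' hd => ?_⟩
  have key := le_regEnergy_sub (radius_pos n) (radius_lt_one n) (arcMeasure b) ν m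
  have e1 : robinConstant b - η ≤ regEnergy (cutoff (radius n)) ν (arcMeasure b) := by
    rw [regEnergy_eq hpos]
    calc robinConstant b - η = ∫ _, (robinConstant b - η) ∂ν := by simp
      _ ≤ _ := by
        refine integral_mono_ae (integrable_const _) (integrable_regPotential hpos _ _) ?_
        filter_upwards [ae_mem_of_compl_null hν'] with x hx
        have := hn2 x hx
        rw [Real.dist_eq] at this
        linarith [(abs_lt.1 this).2]
  have e2 : regEnergy (cutoff (radius n)) (arcMeasure b) (arcMeasure b) ≤ robinConstant b := by
    rw [regEnergy_eq hpos]
    calc _ ≤ ∫ _, robinConstant b ∂(arcMeasure b) := by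
          refine integral_mono_ae (integrable_regPotential hpos _ _) (integrable_const _) ?_
          filter_upwards [ae_mem_of_compl_null (arcMeasure_compl_Icc h0 h1)] with x hx
          exact regPotential_le h0 h1 hpos hx
      _ = robinConstant b := by simp
  have e3 : 4 * η ≤ radius n ^ m / m * ‖moment ν m - moment (arcMeasure b) m‖ ^ 2 :=
    calc 4 * η = 1 / 2 / m * δ ^ 2 := by rw [hη]; field_simp; norm_num
      _ ≤ _ := by gcongr
  linarith

/-! ### Trigonometric moments determine weak convergence -/

lemma cayley_ne_zero (x : ℝ) : cayley x ≠ 0 := fun h => by simpa [h] using norm_cayley x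

/-- The integral powers of the Cayley transform as continuous functions on a subset of the line. -/
noncomputable def cayleyPow (s : Set ℝ) (m : ℤ) : C(s, ℂ) where
  toFun x := cayley x ^ m
  continuous_toFun := (continuous_cayley.comp continuous_subtype_val).zpow₀ m fun x =>
    Or.inl (cayley_ne_zero x)

lemma conj_cayley (x : ℝ) : conj (cayley x) = (cayley x)⁻¹ := by
  rw [Complex.inv_def, Complex.normSq_eq_norm_sq, norm_cayley]; simp

lemma conj_cayley_zpow (x : ℝ) (m : ℤ) : conj (cayley x ^ m) = cayley x ^ (-m) := by
  rw [map_zpow₀, conj_cayley, inv_zpow, zpow_neg]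

/-- The star subalgebra generated by the powers of the Cayley transform. -/
noncomputable def cayleyAlgebra (s : Set ℝ) : StarSubalgebra ℂ C(s, ℂ) where
  toSubalgebra := Algebra.adjoin ℂ (range (cayleyPow s))
  star_mem' := by
    change Algebra.adjoin ℂ (range (cayleyPow s)) ≤ star (Algebra.adjoin ℂ (range (cayleyPow s)))
    refine Algebra.adjoin_le ?_
    rintro - ⟨n, rfl⟩
    exact Algebra.subset_adjoin ⟨-n, ContinuousMap.ext fun x => (conj_cayley_zpow x n).symm⟩

lemma cayleyAlgebra_coe (s : Set ℝ) :
    Subalgebra.toSubmodule (cayleyAlgebra s).toSubalgebra =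
      Submodule.span ℂ (range (cayleyPow s)) := by
  apply Algebra.adjoin_eq_span_of_subset
  refine Subset.trans ?_ Submodule.subset_span
  intro x hx
  refine Submonoid.closure_induction (fun _ => id) ⟨0, ?_⟩ ?_ hx
  · ext1 z; exact zpow_zero _
  · rintro - - - - ⟨m, rfl⟩ ⟨n, rfl⟩
    refine ⟨m + n, ?_⟩
    ext1 z
    exact zpow_add₀ (cayley_ne_zero z) m n

lemma dense_span_cayleyPow (s : Set ℝ) [CompactSpace s] :
    (Submodule.span ℂ (range (cayleyPow s))).topologicalClosure = ⊤ := by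
  rw [← cayleyAlgebra_coe]
  refine congrArg (Subalgebra.toSubmodule <| StarSubalgebra.toSubalgebra ·)
    (ContinuousMap.starSubalgebra_topologicalClosure_eq_top_of_separatesPoints (cayleyAlgebra s)
      fun x y hxy => ⟨_, ⟨cayleyPow s 1, Algebra.subset_adjoin ⟨1, rfl⟩, rfl⟩, fun h => hxy ?_⟩)
  have h' : cayley x ^ (1 : ℤ) = cayley y ^ (1 : ℤ) := h
  rw [zpow_one, zpow_one] at h'
  exact Subtype.ext (cayley_injective h')

/-- Since `|cayley x| = 1`, the moments of negative order are conjugate to the others. -/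
lemma integral_cayley_neg (μ : Measure ℝ) (m : ℕ) :
    ∫ x, cayley x ^ (-(m : ℤ)) ∂μ = conj (moment μ m) := by
  rw [moment, ← integral_conj]
  congr 1; ext x
  rw [← conj_cayley_zpow, zpow_natCast]

/-- Every continuous function on `s` is uniformly close to a linear combination of powers of the
Cayley transform, so convergence of the moments implies convergence of its integrals. -/
lemma tendsto_integral_of_tendsto_moment {s : Set ℝ} (hs : IsCompact s) {μ : Measure ℝ}
    {ν : ℕ → Measure ℝ} [IsProbabilityMeasure μ] (hμ : μ sᶜ = 0)
    (hν : ∀ᶠ n in atTop, IsProbabilityMeasure (ν n) ∧ ν n sᶜ = 0)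
    (h : ∀ m : ℕ, 1 ≤ m → Tendsto (fun n => moment (ν n) m) atTop (𝓝 (moment μ m)))
    (f : ℝ →ᵇ ℝ) : Tendsto (fun n => ∫ x, f x ∂(ν n)) atTop (𝓝 (∫ x, f x ∂μ)) := by
  have : CompactSpace s := isCompact_iff_compactSpace.1 hs
  have hbase : ∀ m : ℤ, Tendsto (fun n => ∫ x, cayley x ^ m ∂(ν n)) atTop
      (𝓝 (∫ x, cayley x ^ m ∂μ)) := by
    intro m
    obtain ⟨k, rfl | rfl⟩ := m.eq_nat_or_neg
    · simp only [zpow_natCast]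
      rcases Nat.eq_zero_or_pos k with rfl | hk
      · refine tendsto_const_nhds.congr' ?_
        filter_upwards [hν] with n hn
        have := hn.1
        simp
      · exact h k hk
    · simp only [integral_cayley_neg]
      rcases Nat.eq_zero_or_pos k with rfl | hk
      · refine tendsto_const_nhds.congr' ?_
        filter_upwards [hν] with n hn
        have := hn.1
        simp [moment]
      · exact (Complex.continuous_conj.tendsto _).comp (h k hk)
  have hint : ∀ (m : ℤ) (ρ : Measure ℝ) [IsFiniteMeasure ρ], Integrable (fun x => cayley x ^ m) ρ :=
    fun m ρ _ => Integrable.of_bound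
      (continuous_cayley.zpow₀ m fun x => Or.inl (cayley_ne_zero x)).aestronglyMeasurable 1
      (Eventually.of_forall fun x => by simp [norm_cayley])
  -- The claim for linear combinations, extended from `s` to functions on the whole line.
  have hspan : ∀ g ∈ Submodule.span ℂ (range (cayleyPow s)), ∃ G : ℝ → ℂ, (∀ x : s, G x = g x) ∧
      (∀ (ρ : Measure ℝ) [IsFiniteMeasure ρ], Integrable G ρ) ∧
      Tendsto (fun n => ∫ x, G x ∂(ν n)) atTop (𝓝 (∫ x, G x ∂μ)) := by
    intro g hg
    induction hg using Submodule.span_induction with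
    | mem g hg =>
      obtain ⟨m, rfl⟩ := hg
      exact ⟨fun x => cayley x ^ m, fun x => rfl, fun ρ _ => hint m ρ, hbase m⟩
    | zero => exact ⟨0, fun x => rfl, fun ρ _ => integrable_zero _ _ _, by simp⟩
    | add g₁ g₂ _ _ h₁ h₂ =>
      obtain ⟨G₁, a₁, i₁, t₁⟩ := h₁
      obtain ⟨G₂, a₂, i₂, t₂⟩ := h₂
      refine ⟨fun x => G₁ x + G₂ x, fun x => by simp [a₁, a₂], fun ρ _ => (i₁ ρ).add (i₂ ρ), ?_⟩
      rw [integral_add (i₁ μ) (i₂ μ)]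
      refine (t₁.add t₂).congr' ?_
      filter_upwards [hν] with n hn
      have := hn.1
      rw [integral_add (i₁ _) (i₂ _)]
    | smul c g _ hg =>
      obtain ⟨G, a, i, t⟩ := hg
      refine ⟨fun x => c * G x, fun x => by simp [a], fun ρ _ => (i ρ).const_mul c, ?_⟩
      simp only [integral_const_mul]
      exact t.const_mul c
  let F : C(s, ℂ) := ⟨fun x => (f x : ℂ), by fun_prop⟩
  have hF :
      F ∈ closure ((Submodule.span ℂ (range (cayleyPow s)) : Submodule ℂ C(s, ℂ)) : Set _) := by
    have : F ∈ (Submodule.span ℂ (range (cayleyPow s))).topologicalClosure := by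
      rw [dense_span_cayleyPow]; trivial
    exact this
  rw [Metric.tendsto_atTop']
  intro ε hε
  obtain ⟨g, hg, hgF⟩ := Metric.mem_closure_iff.1 hF (ε / 3) (by positivity)
  obtain ⟨G, hGg, hGi, hGt⟩ := hspan g hg
  have hclose : ∀ ρ : Measure ℝ, IsProbabilityMeasure ρ → ρ sᶜ = 0 →
      ‖((∫ x, f x ∂ρ : ℝ) : ℂ) - ∫ x, G x ∂ρ‖ ≤ ε / 3 := by
    intro ρ _ hρ
    have hfi : Integrable (fun x => (f x : ℂ)) ρ := (f.integrable ρ).ofReal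
    rw [← integral_complex_ofReal, ← integral_sub hfi (hGi ρ)]
    have := norm_integral_le_of_norm_le_const (μ := ρ) (f := fun x => (f x : ℂ) - G x)
      (C := ε / 3) (by
        filter_upwards [ae_mem_of_compl_null hρ] with x hx
        have h1 := (ContinuousMap.dist_apply_le_dist (f := F) (g := g) ⟨x, hx⟩).trans hgF.le
        rw [dist_eq_norm, ← hGg] at h1
        exact h1)
    simpa using this
  obtain ⟨N, hN⟩ := eventually_atTop.1 (hν.and (Metric.tendsto_nhds.1 hGt (ε / 3) (by positivity)))
  refine ⟨N, fun n hn => ?_⟩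
  obtain ⟨⟨p1, p2⟩, p3⟩ := hN n hn.le
  have q1 := hclose _ p1 p2
  have q2 := hclose μ inferInstance hμ
  rw [dist_eq_norm] at p3
  rw [dist_eq_norm, ← Complex.norm_real, Complex.ofReal_sub]
  rw [norm_sub_rev] at q2
  calc ‖((∫ x, f x ∂(ν n) : ℝ) : ℂ) - ((∫ x, f x ∂μ : ℝ) : ℂ)‖
      = ‖(((∫ x, f x ∂(ν n) : ℝ) : ℂ) - ∫ x, G x ∂(ν n)) + (∫ x, G x ∂(ν n) - ∫ x, G x ∂μ) +
        (∫ x, G x ∂μ - ((∫ x, f x ∂μ : ℝ) : ℂ))‖ := by congr 1; ring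
    _ ≤ _ := norm_add₃_le
    _ < ε := by linarith

/-- A probability measure on a compact set is determined by its trigonometric moments. -/
lemma eq_of_moment_eq {s : Set ℝ} (hs : IsCompact s) {μ ν : Measure ℝ} [IsProbabilityMeasure μ]
    [IsProbabilityMeasure ν] (hμ : μ sᶜ = 0) (hν : ν sᶜ = 0)
    (h : ∀ m : ℕ, 1 ≤ m → moment ν m = moment μ m) : ν = μ :=
  ext_of_forall_integral_eq_of_IsFiniteMeasure fun f =>
    tendsto_nhds_unique tendsto_const_nhds
      (tendsto_integral_of_tendsto_moment (ν := fun _ => ν) hs hμ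
        (Eventually.of_forall fun _ => ⟨inferInstance, hν⟩)
        (fun m hm => by rw [h m hm]; exact tendsto_const_nhds) f)

/-! ### The eigenvalue density in terms of the chordal distance -/

/-- The potential `log (1 + x²)`. -/
noncomputable def cauchyPotential (x : ℝ) : ℝ := Real.log (1 + x ^ 2)

lemma cauchyPotential_nonneg (x : ℝ) : 0 ≤ cauchyPotential x :=
  Real.log_nonneg (by nlinarith [sq_nonneg x])

lemma continuous_cauchyPotential : Continuous cauchyPotential := by
  unfold cauchyPotential
  exact Continuous.log (by fun_prop) fun x => by positivity

lemma domain_coe (a : ℝ) : domain ((-a : ℝ) : EReal) (a : EReal) = Icc (-a) a := by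
  ext x; simp only [domain, mem_ofPred_eq, EReal.coe_le_coe_iff, mem_Icc]

/-- The unnormalised eigenvalue density for the potential `log (1 + x²)`. -/
noncomputable def gasDensity (n : ℕ) (t : Fin n → ℝ) : ℝ :=
  (Matrix.vandermonde t).det ^ 2 * Real.exp (-(n : ℝ) * ∑ k, cauchyPotential (t k))

lemma continuous_gasDensity (n : ℕ) : Continuous (gasDensity n) := by
  have := continuous_cauchyPotential
  have h : Continuous fun t : Fin n → ℝ => (Matrix.vandermonde t).det := by
    simp only [Matrix.det_vandermonde]; fun_prop
  unfold gasDensity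
  fun_prop

lemma two_mul_sum_Ioi {n : ℕ} (S : Fin n → Fin n → ℝ) (hS : ∀ i j, S i j = S j i) :
    2 * ∑ i, ∑ j ∈ Finset.Ioi i, S i j = ∑ i, ∑ j, S i j - ∑ i, S i i := by
  have h1 : ∑ i, ∑ j ∈ Finset.Iio i, S i j = ∑ i, ∑ j ∈ Finset.Ioi i, S i j := by
    rw [Finset.sum_comm' (t' := Finset.univ) (s' := fun j => Finset.Ioi j) (by simp)]
    exact Finset.sum_congr rfl fun i _ => Finset.sum_congr rfl fun j _ => hS j i
  have h2 : ∀ i, ∑ j, S i j = S i i + ∑ j ∈ Finset.Iio i, S i j + ∑ j ∈ Finset.Ioi i, S i j := by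
    intro i
    have hu : (Finset.univ : Finset (Fin n)) = insert i (Finset.Iio i ∪ Finset.Ioi i) := by
      ext j; simp [eq_comm, lt_or_lt_iff_ne, em]
    rw [hu, Finset.sum_insert (by simp), Finset.sum_union, add_assoc]
    rw [Finset.disjoint_left]
    intro j hj hj'
    simp only [Finset.mem_Iio, Finset.mem_Ioi] at hj hj'
    exact absurd hj hj'.asymm
  simp only [h2, Finset.sum_add_distrib, h1]
  ring

/-- Each pair contributes `(1 + tᵢ²) (1 + tⱼ²)` when `(tᵢ - tⱼ)²` is replaced by the chordal
distance. This makes `n - 1` factors `1 + tᵢ²` for each `i`, and the potential term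
`(1 + tᵢ²) ^ (-n)` leaves one of them in the denominator. -/
lemma gasDensity_eq (n : ℕ) (t : Fin n → ℝ) : gasDensity n t =
    (∏ i, ∏ j ∈ Finset.Ioi i, chordalSq (t i) (t j)) * Real.exp (-∑ i, cauchyPotential (t i)) := by
  have h1 : ∀ x y : ℝ, (y - x) ^ 2 =
      chordalSq x y * Real.exp (cauchyPotential x + cauchyPotential y) := by
    intro x y
    rw [Real.exp_add, cauchyPotential, cauchyPotential, Real.exp_log (by positivity),
      Real.exp_log (by positivity), chordalSq]
    field_simp
    ring
  have h2 := two_mul_sum_Ioi (fun i j => cauchyPotential (t i) + cauchyPotential (t j))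
    (fun i j => add_comm _ _)
  have h3 : ∑ i, ∑ j, (cauchyPotential (t i) + cauchyPotential (t j)) =
      2 * n * ∑ i, cauchyPotential (t i) := by
    simp only [Finset.sum_add_distrib, Finset.sum_const, Finset.card_univ, Fintype.card_fin,
      nsmul_eq_mul, ← Finset.mul_sum]
    ring
  rw [h3] at h2
  simp only [Finset.sum_add_distrib (f := fun i => cauchyPotential (t i))
    (g := fun i => cauchyPotential (t i))] at h2
  rw [gasDensity, Matrix.det_vandermonde, ← Finset.prod_pow]
  simp only [← Finset.prod_pow, h1, Finset.prod_mul_distrib, ← Real.exp_sum]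
  rw [mul_assoc, ← Real.exp_add]
  congr 2
  linarith

lemma integral_empiricalMeasure {E : Type*} [NormedAddCommGroup E] [NormedSpace ℝ E]
    [CompleteSpace E] (n : ℕ) (t : Fin n → ℝ) (f : ℝ → E) :
    ∫ x, f x ∂(empiricalMeasure n t) = (n : ℝ)⁻¹ • ∑ i, f (t i) := by
  rw [empiricalMeasure, integral_smul_measure, integral_finsetSum_measure]
  · simp
  · intro i _
    exact integrable_dirac enorm_lt_top

lemma isProbabilityMeasure_empiricalMeasure {n : ℕ} (hn : 1 ≤ n) (t : Fin n → ℝ) :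
    IsProbabilityMeasure (empiricalMeasure n t) := by
  constructor
  rw [empiricalMeasure, Measure.smul_apply, Measure.finsetSum_apply]
  simp only [measure_univ, Finset.sum_const, Finset.card_univ, Fintype.card_fin, nsmul_eq_mul,
    mul_one, smul_eq_mul]
  exact ENNReal.inv_mul_cancel (by simpa using Nat.one_le_iff_ne_zero.1 hn) (by simp)

lemma empiricalMeasure_compl {n : ℕ} {t : Fin n → ℝ} {s : Set ℝ} (hs : MeasurableSet s)
    (ht : ∀ i, t i ∈ s) : empiricalMeasure n t sᶜ = 0 := by
  rw [empiricalMeasure, Measure.smul_apply, Measure.finsetSum_apply]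
  simp [Measure.dirac_apply' _ hs.compl, ht]

lemma regEnergy_empiricalMeasure {h : ℝ} (hh : 0 < h) {n : ℕ} (hn : 1 ≤ n) (t : Fin n → ℝ) :
    ∑ i, ∑ j, regKernel h (t i) (t j) =
      n ^ 2 * regEnergy h (empiricalMeasure n t) (empiricalMeasure n t) := by
  have := isProbabilityMeasure_empiricalMeasure hn t
  have hn' : (n : ℝ) ≠ 0 := by exact_mod_cast Nat.one_le_iff_ne_zero.1 hn
  rw [regEnergy_eq hh, integral_empiricalMeasure]
  simp only [regPotential, integral_empiricalMeasure, smul_eq_mul, ← Finset.mul_sum]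
  field_simp

/-- The off-diagonal energy exceeds its regularisation, which includes the diagonal terms
`-(log h) / 2`; these are of order `n` only. -/
lemma gasDensity_le {h : ℝ} (hh : 0 < h) {n : ℕ} (hn : 1 ≤ n) (t : Fin n → ℝ) :
    gasDensity n t ≤ Real.exp (-(n ^ 2 * regEnergy h (empiricalMeasure n t)
      (empiricalMeasure n t)) - n * (Real.log h / 2)) := by
  have h1 : ∀ x y : ℝ, chordalSq x y ≤ Real.exp (-2 * regKernel h x y) := by
    intro x y
    have := chordalSq_nonneg x y
    rw [show -2 * regKernel h x y = Real.log (h + chordalSq x y) by unfold regKernel; ring,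
      Real.exp_log (by positivity)]
    linarith
  have h2 := two_mul_sum_Ioi (fun i j => regKernel h (t i) (t j))
    (fun i j => regKernel_comm h (t i) (t j))
  have h3 : ∑ i, regKernel h (t i) (t i) = -(n * (Real.log h / 2)) := by
    simp only [regKernel, chordalSq_self, add_zero, Finset.sum_const, Finset.card_univ,
      Fintype.card_fin, nsmul_eq_mul]
    ring
  rw [regEnergy_empiricalMeasure hh hn, h3] at h2
  have h4 : 0 ≤ ∑ i, cauchyPotential (t i) :=
    Finset.sum_nonneg fun i _ => cauchyPotential_nonneg _
  calc gasDensity n t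
      ≤ (∏ i, ∏ j ∈ Finset.Ioi i, Real.exp (-2 * regKernel h (t i) (t j))) *
        Real.exp (-∑ i, cauchyPotential (t i)) := by
        rw [gasDensity_eq]
        refine mul_le_mul_of_nonneg_right ?_ (Real.exp_pos _).le
        refine Finset.prod_le_prod (fun i _ => Finset.prod_nonneg fun j _ =>
          chordalSq_nonneg _ _) fun i _ => ?_
        exact Finset.prod_le_prod (fun j _ => chordalSq_nonneg _ _) fun j _ => h1 _ _
    _ = Real.exp (-(2 * ∑ i, ∑ j ∈ Finset.Ioi i, regKernel h (t i) (t j)) -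
        ∑ i, cauchyPotential (t i)) := by
        simp only [← Real.exp_sum, ← Finset.mul_sum]
        rw [← Real.exp_add]
        congr 1; ring
    _ ≤ _ := by
        rw [Real.exp_le_exp, h2]
        linarith

/-- The diagonal terms of the double sum vanish, because `Real.log 0 = 0`. -/
lemma gasDensity_eq_exp {n : ℕ} {t : Fin n → ℝ} (ht : Function.Injective t) :
    gasDensity n t = Real.exp (1 / 2 * ∑ i, ∑ j, Real.log (chordalSq (t i) (t j)) -
      ∑ i, cauchyPotential (t i)) := by
  have h2 := two_mul_sum_Ioi (fun i j => Real.log (chordalSq (t i) (t j)))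
    (fun i j => by rw [chordalSq_comm])
  simp only [chordalSq_self, Real.log_zero, Finset.sum_const_zero, sub_zero] at h2
  have h3 : ∏ i, ∏ j ∈ Finset.Ioi i, chordalSq (t i) (t j) =
      Real.exp (∑ i, ∑ j ∈ Finset.Ioi i, Real.log (chordalSq (t i) (t j))) := by
    simp only [Real.exp_sum]
    refine Finset.prod_congr rfl fun i _ => Finset.prod_congr rfl fun j hj => ?_
    rw [Real.exp_log (chordalSq_pos fun h => (Finset.mem_Ioi.1 hj).ne (ht h))]
  rw [gasDensity_eq, h3, ← Real.exp_add, ← h2]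
  congr 1; ring

/-! ### Upper bound for the weight of an atypical event -/

lemma measurable_moment_empiricalMeasure (n m : ℕ) :
    Measurable fun t : Fin n → ℝ => moment (empiricalMeasure n t) m := by
  have := continuous_cayley
  simp only [moment, integral_empiricalMeasure]
  exact Continuous.measurable (by fun_prop)

/-- The configurations whose `m`-th empirical moment is at distance at least `δ` from `z`. -/
def momentEvent (n m : ℕ) (δ : ℝ) (z : ℂ) : Set (Fin n → ℝ) :=
  {t | δ ≤ ‖moment (empiricalMeasure n t) m - z‖}

lemma measurableSet_momentEvent (n m : ℕ) (δ : ℝ) (z : ℂ) :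
    MeasurableSet (momentEvent n m δ z) :=
  measurableSet_le measurable_const ((measurable_moment_empiricalMeasure n m).sub_const z).norm

lemma weightMeasure_eq (a : ℝ) (n : ℕ) :
    weightMeasure cauchyPotential ((-a : ℝ) : EReal) (a : EReal) n =
      (Measure.pi fun _ : Fin n => volume.restrict (Icc (-a) a)).withDensity
        fun t => ENNReal.ofReal (gasDensity n t) := by
  rw [weightMeasure, domain_coe, volume_pi, Measure.restrict_pi_pi]
  rfl

lemma ae_mem_pi_Icc (a : ℝ) (n : ℕ) :
    ∀ᵐ t ∂(Measure.pi fun _ : Fin n => (volume : Measure ℝ).restrict (Icc (-a) a)),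
      ∀ i, t i ∈ Icc (-a) a := by
  rw [← Measure.restrict_pi_pi]
  filter_upwards [ae_restrict_mem (MeasurableSet.univ_pi fun _ => measurableSet_Icc)] with t ht i
  exact ht i (mem_univ i)

lemma pi_Icc_univ {a : ℝ} (ha : 0 < a) (n : ℕ) :
    (Measure.pi fun _ : Fin n => (volume : Measure ℝ).restrict (Icc (-a) a)) univ =
      ENNReal.ofReal (Real.exp (n * Real.log (2 * a))) := by
  rw [Measure.pi_univ]
  simp only [Measure.restrict_apply_univ, Real.volume_Icc, Finset.prod_const, Finset.card_univ,
    Fintype.card_fin]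
  rw [← ENNReal.ofReal_pow (by linarith), Real.exp_nat_mul, Real.exp_log (by linarith)]
  congr 2; ring

lemma weightMeasure_le_of_forall_le {a C : ℝ} (ha : 0 < a) (n : ℕ) {s : Set (Fin n → ℝ)}
    (hs : MeasurableSet s)
    (hC : ∀ t ∈ s, (∀ i, t i ∈ Icc (-a) a) → gasDensity n t ≤ Real.exp C) :
    weightMeasure cauchyPotential ((-a : ℝ) : EReal) (a : EReal) n s ≤
      ENNReal.ofReal (Real.exp (C + n * Real.log (2 * a))) := by
  rw [weightMeasure_eq, withDensity_apply _ hs]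
  calc ∫⁻ t in s, ENNReal.ofReal (gasDensity n t)
        ∂(Measure.pi fun _ : Fin n => (volume : Measure ℝ).restrict (Icc (-a) a))
      ≤ ∫⁻ t in s, ENNReal.ofReal (Real.exp C)
        ∂(Measure.pi fun _ : Fin n => (volume : Measure ℝ).restrict (Icc (-a) a)) := by
        refine lintegral_mono_ae ?_
        rw [ae_restrict_iff' hs]
        filter_upwards [ae_mem_pi_Icc a n] with t ht hts
        exact ENNReal.ofReal_le_ofReal (hC t hts ht)
    _ ≤ ∫⁻ t, ENNReal.ofReal (Real.exp C)
        ∂(Measure.pi fun _ : Fin n => (volume : Measure ℝ).restrict (Icc (-a) a)) :=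
        setLIntegral_le_lintegral _ _
    _ = _ := by
        rw [lintegral_const, pi_Icc_univ ha, ← ENNReal.ofReal_mul (Real.exp_pos _).le,
          ← Real.exp_add]

lemma weightMeasure_univ_ne_top {a : ℝ} (ha : 0 < a) (n : ℕ) :
    weightMeasure cauchyPotential ((-a : ℝ) : EReal) (a : EReal) n univ ≠ ⊤ := by
  refine ne_top_of_le_ne_top ENNReal.ofReal_ne_top
    (weightMeasure_le_of_forall_le ha n (C := 0) MeasurableSet.univ fun t _ _ => ?_)
  rw [gasDensity_eq, Real.exp_zero]
  refine mul_le_one₀ ?_ (Real.exp_pos _).le ?_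
  · exact Finset.prod_le_one (fun i _ => Finset.prod_nonneg fun j _ => chordalSq_nonneg _ _)
      fun i _ => Finset.prod_le_one (fun j _ => chordalSq_nonneg _ _)
        fun j _ => chordalSq_le_one _ _
  · rw [Real.exp_le_one_iff, neg_nonpos]
    exact Finset.sum_nonneg fun i _ => cauchyPotential_nonneg _

/-- A configuration with an atypical moment has energy at least `n² (c + κ)` up to terms of order
`n`, where `c` is the energy of the arc measure. -/
lemma exists_weightMeasure_momentEvent_le {b : ℝ} (h0 : 0 < b) (h1 : b < 1) {m : ℕ} (hm : 1 ≤ m)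
    {δ : ℝ} (hδ : 0 < δ) : ∃ κ > 0, ∃ C : ℝ, ∀ n : ℕ, 1 ≤ n →
      weightMeasure cauchyPotential ((-tanOfSin b : ℝ) : EReal) (tanOfSin b : EReal) n
        (momentEvent n m δ (moment (arcMeasure b) m)) ≤
      ENNReal.ofReal (Real.exp (-(n ^ 2 * (robinConstant b + κ)) + n * C)) := by
  obtain ⟨h, hh, κ, hκ, H⟩ := exists_regEnergy_gap h0 h1 hm hδ
  refine ⟨κ, hκ, -(Real.log h / 2) + Real.log (2 * tanOfSin b), fun n hn => ?_⟩
  have := weightMeasure_le_of_forall_le (tanOfSin_pos h0 h1) n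
    (measurableSet_momentEvent n m δ (moment (arcMeasure b) m))
    (C := -(n ^ 2 * (robinConstant b + κ)) - n * (Real.log h / 2)) fun t ht hti => by
      refine (gasDensity_le hh hn t).trans (Real.exp_le_exp.2 ?_)
      have e := H (empiricalMeasure n t) (isProbabilityMeasure_empiricalMeasure hn t)
        (empiricalMeasure_compl measurableSet_Icc hti) ht
      have : (n : ℝ) ^ 2 * (robinConstant b + κ) ≤
        n ^ 2 * regEnergy h (empiricalMeasure n t) (empiricalMeasure n t) := by gcongr
      linarith
  refine this.trans_eq ?_
  congr 2; ring

/-! ### Lower bound for the partition function -/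

/-- Jensen's inequality for the exponential, with a possibly infinite right-hand side. -/
lemma ofReal_exp_integral_le_lintegral {Ω : Type*} [MeasurableSpace Ω] (P : Measure Ω)
    [IsProbabilityMeasure P] {Y : Ω → ℝ} (hY : Integrable Y P) :
    ENNReal.ofReal (Real.exp (∫ ω, Y ω ∂P)) ≤ ∫⁻ ω, ENNReal.ofReal (Real.exp (Y ω)) ∂P := by
  by_cases h : ∫⁻ ω, ENNReal.ofReal (Real.exp (Y ω)) ∂P = ⊤
  · rw [h]; exact le_top
  have hm : AEStronglyMeasurable (fun ω => Real.exp (Y ω)) P :=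
    Real.continuous_exp.comp_aestronglyMeasurable hY.aestronglyMeasurable
  have hi : Integrable (fun ω => Real.exp (Y ω)) P :=
    (lintegral_ofReal_ne_top_iff_integrable hm
      (Eventually.of_forall fun ω => (Real.exp_pos _).le)).1 h
  rw [← ofReal_integral_eq_lintegral_ofReal hi (Eventually.of_forall fun ω => (Real.exp_pos _).le)]
  exact ENNReal.ofReal_le_ofReal (convexOn_exp.map_integral_le Real.continuous_exp.continuousOn
    isClosed_univ (Eventually.of_forall fun ω => mem_univ _) hY hi)

/-- A product of densities is the density of the product measure. -/
lemma pi_withDensity_prod {n : ℕ} (μ : Measure ℝ) [IsProbabilityMeasure μ] {w : ℝ → ENNReal}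
    (hw : Measurable w) [SigmaFinite (μ.withDensity w)] :
    (Measure.pi fun _ : Fin n => μ.withDensity w) =
      (Measure.pi fun _ : Fin n => μ).withDensity fun t => ∏ i, w (t i) := by
  refine Measure.pi_eq fun s hs => ?_
  have hX : ∀ i, Measurable ((s i).indicator w) := fun i => hw.indicator (hs i)
  have e : ∀ t : Fin n → ℝ, (univ.pi s).indicator (fun t => ∏ i, w (t i)) t =
      ∏ i, (s i).indicator w (t i) := by
    intro t
    by_cases ht : t ∈ univ.pi s
    · rw [indicator_of_mem ht]
      exact Finset.prod_congr rfl fun i _ => (indicator_of_mem (ht i (mem_univ i)) _).symm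
    · rw [indicator_of_notMem ht]
      simp only [Set.mem_pi, mem_univ, true_imp_iff, not_forall] at ht
      obtain ⟨i, hi⟩ := ht
      exact (Finset.prod_eq_zero (Finset.mem_univ i) (indicator_of_notMem hi _)).symm
  rw [withDensity_apply _ (MeasurableSet.univ_pi hs),
    ← lintegral_indicator (MeasurableSet.univ_pi hs)]
  simp only [e]
  have hind := ProbabilityTheory.iIndepFun_pi (μ := fun _ : Fin n => μ)
    (X := fun i => (s i).indicator w) fun i => (hX i).aemeasurable
  rw [ProbabilityTheory.lintegral_prod_eq_prod_lintegral_of_indepFun Finset.univ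
    (fun i (t : Fin n → ℝ) => (s i).indicator w (t i)) hind
    fun i => (hX i).comp (measurable_pi_apply i)]
  refine Finset.prod_congr rfl fun i _ => ?_
  rw [withDensity_apply _ (hs i), ← lintegral_indicator (hs i)]
  exact (measurePreserving_eval (fun _ : Fin n => μ) i).lintegral_comp (hX i)

lemma map_eval_pair {n : ℕ} (μ : Measure ℝ) [IsProbabilityMeasure μ] {i j : Fin n} (hij : i ≠ j) :
    (Measure.pi fun _ : Fin n => μ).map (fun t => (t i, t j)) = μ.prod μ := by
  have hind := (ProbabilityTheory.iIndepFun_pi (μ := fun _ : Fin n => μ)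
    (X := fun _ => id) fun i => aemeasurable_id).indepFun hij
  simp only [id] at hind
  rw [(ProbabilityTheory.indepFun_iff_map_prod_eq_prod_map_map
    (measurable_pi_apply i).aemeasurable (measurable_pi_apply j).aemeasurable).1 hind]
  congr 1
  · exact (measurePreserving_eval (fun _ : Fin n => μ) i).map_eq
  · exact (measurePreserving_eval (fun _ : Fin n => μ) j).map_eq

/-- The diagonal is a null set for the product with a measure without atoms. -/
lemma ae_prod_ne (μ ν : Measure ℝ) [SFinite μ] [SFinite ν] [NullSingletonClass ν] :
    ∀ᵐ p ∂(μ.prod ν), p.1 ≠ p.2 := by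
  have hm : MeasurableSet {p : ℝ × ℝ | p.1 = p.2} :=
    measurableSet_eq_fun measurable_fst measurable_snd
  have : (μ.prod ν) {p : ℝ × ℝ | p.1 = p.2} = 0 := by
    rw [Measure.measure_prod_null hm]
    refine Eventually.of_forall fun x => ?_
    have : Prod.mk x ⁻¹' {p : ℝ × ℝ | p.1 = p.2} = {x} := by ext y; simp [eq_comm]
    simp [this]
  rw [ae_iff]
  simpa using this

lemma ae_injective_pi {n : ℕ} (μ : Measure ℝ) [IsProbabilityMeasure μ] [NullSingletonClass μ] :
    ∀ᵐ t ∂(Measure.pi fun _ : Fin n => μ), Function.Injective t := by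
  have h : ∀ i j : Fin n, i ≠ j → ∀ᵐ t ∂(Measure.pi fun _ : Fin n => μ), t i ≠ t j := by
    intro i j hij
    have := ae_prod_ne μ μ
    rw [← map_eval_pair μ hij] at this
    exact ae_of_ae_map ((measurable_pi_apply i).prodMk (measurable_pi_apply j)).aemeasurable this
  have h' : ∀ᵐ t ∂(Measure.pi fun _ : Fin n => μ), ∀ i j : Fin n, i ≠ j → t i ≠ t j := by
    simp only [eventually_all]
    exact h
  filter_upwards [h'] with t ht i j hij
  by_contra hne
  exact ht i j hne hij

lemma measurable_log_chordalSq_prod : Measurable fun p : ℝ × ℝ => Real.log (chordalSq p.1 p.2) :=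
  Real.measurable_log.comp continuous_chordalSq.measurable

lemma integrable_log_chordalSq_prod {b : ℝ} (h0 : 0 < b) (h1 : b < 1) :
    Integrable (fun p : ℝ × ℝ => Real.log (chordalSq p.1 p.2))
      ((arcMeasure b).prod (arcMeasure b)) := by
  have hae := ae_mem_of_compl_null (arcMeasure_compl_Icc h0 h1)
  rw [integrable_prod_iff measurable_log_chordalSq_prod.aestronglyMeasurable]
  refine ⟨?_, ?_⟩
  · filter_upwards [hae] with x hx using integrable_log_chordalSq h0 h1 hx
  · refine (integrable_const (-(2 * Real.log (b / 2)))).congr ?_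
    filter_upwards [hae] with x hx
    rw [← integral_log_chordalSq h0 h1 hx, ← integral_neg]
    congr 1; ext y
    rw [Real.norm_eq_abs, abs_of_nonpos (log_chordalSq_nonpos x y)]

lemma integral_log_chordalSq_prod {b : ℝ} (h0 : 0 < b) (h1 : b < 1) :
    ∫ p : ℝ × ℝ, Real.log (chordalSq p.1 p.2) ∂((arcMeasure b).prod (arcMeasure b)) =
      -(2 * robinConstant b) := by
  have hae := ae_mem_of_compl_null (arcMeasure_compl_Icc h0 h1)
  rw [integral_prod _ (integrable_log_chordalSq_prod h0 h1),
    integral_congr_ae (g := fun _ => 2 * Real.log (b / 2))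
      (by filter_upwards [hae] with x hx using integral_log_chordalSq h0 h1 hx)]
  simp [robinConstant]

lemma integrable_log_chordalSq_eval {b : ℝ} (h0 : 0 < b) (h1 : b < 1) {n : ℕ} (i j : Fin n) :
    Integrable (fun t : Fin n → ℝ => Real.log (chordalSq (t i) (t j)))
      (Measure.pi fun _ : Fin n => arcMeasure b) := by
  by_cases hij : i = j
  · subst hij; simp [chordalSq_self]
  · have h := integrable_log_chordalSq_prod h0 h1
    rw [← map_eval_pair (arcMeasure b) hij] at h
    exact h.comp_measurable ((measurable_pi_apply i).prodMk (measurable_pi_apply j))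

lemma robinConstant_nonneg {b : ℝ} (h0 : 0 < b) (h1 : b < 1) : 0 ≤ robinConstant b := by
  have := Real.log_nonpos (by positivity : 0 ≤ b / 2) (by linarith)
  unfold robinConstant; linarith

/-- The bound is an equality for `i ≠ j`; for `i = j` the integrand is `Real.log 0 = 0`. -/
lemma le_integral_log_chordalSq_eval {b : ℝ} (h0 : 0 < b) (h1 : b < 1) {n : ℕ} (i j : Fin n) :
    -(2 * robinConstant b) ≤ ∫ t : Fin n → ℝ, Real.log (chordalSq (t i) (t j))
      ∂(Measure.pi fun _ : Fin n => arcMeasure b) := by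
  by_cases hij : i = j
  · subst hij
    have := robinConstant_nonneg h0 h1
    simp [chordalSq_self, this]
  · rw [← integral_log_chordalSq_prod h0 h1, ← map_eval_pair (arcMeasure b) hij,
      integral_map ((measurable_pi_apply i).prodMk (measurable_pi_apply j)).aemeasurable
        measurable_log_chordalSq_prod.aestronglyMeasurable]

lemma integrable_cauchyPotential {b : ℝ} (h0 : 0 < b) (h1 : b < 1) :
    Integrable cauchyPotential (arcMeasure b) := by
  obtain ⟨C, hC⟩ :=
    (isCompact_Icc (a := -tanOfSin b) (b := tanOfSin b)).exists_bound_of_continuousOn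
      continuous_cauchyPotential.continuousOn
  refine Integrable.of_bound continuous_cauchyPotential.aestronglyMeasurable C ?_
  filter_upwards [ae_mem_of_compl_null (arcMeasure_compl_Icc h0 h1)] with x hx using hC x hx

/-- The logarithm of the density of the measure `dx / (1 + x²)` with respect to the arc measure,
expressed through the potentials of the two edges. -/
noncomputable def logArcWeight (b x : ℝ) : ℝ :=
  Real.log (Real.pi * √(1 - b ^ 2)) + (Real.log (chordalSq (tanOfSin b) x) +
    Real.log (chordalSq (-tanOfSin b) x)) / 4 +
    (cauchyPotential (tanOfSin b) + cauchyPotential x) / 2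

lemma integrable_logArcWeight {b : ℝ} (h0 : 0 < b) (h1 : b < 1) :
    Integrable (logArcWeight b) (arcMeasure b) := by
  have ha := tanOfSin_pos h0 h1
  have hl := integrable_cauchyPotential h0 h1
  exact ((integrable_const _).add (((integrable_log_chordalSq h0 h1
    (right_mem_Icc.2 (by linarith))).add (integrable_log_chordalSq h0 h1
    (left_mem_Icc.2 (by linarith)))).div_const 4)).add (((integrable_const _).add hl).div_const 2)

lemma inv_arcDensityAux {b x : ℝ} (h0 : 0 < b) (h1 : b < 1)
    (hx : x ∈ Ioo (-tanOfSin b) (tanOfSin b)) :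
    (arcDensityAux b x)⁻¹ = Real.exp (logArcWeight b x + cauchyPotential x) := by
  have hb : 0 < 1 - b ^ 2 := by nlinarith
  have hq := Real.sqrt_pos.2 hb
  have h2 : 0 < tanOfSin b - x := by linarith [hx.2]
  have h3 : 0 < tanOfSin b + x := by linarith [hx.1]
  have h4 : 0 < tanOfSin b ^ 2 - x ^ 2 := by nlinarith
  have h5 := Real.sqrt_pos.2 h4
  have h6 : Real.log √(tanOfSin b ^ 2 - x ^ 2) =
      (Real.log (tanOfSin b - x) + Real.log (tanOfSin b + x)) / 2 := by
    rw [Real.log_sqrt h4.le, sq_sub_sq, Real.log_mul h3.ne' h2.ne']; ring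
  have h7 : Real.log |(-tanOfSin b) - x| = Real.log (tanOfSin b + x) := by
    rw [Real.log_abs, ← Real.log_neg_eq_log]; congr 1; ring
  have h8 : (0 : ℝ) < 1 + x ^ 2 := by positivity
  have h9 : Real.log (Real.pi * √(1 - b ^ 2) * (1 + x ^ 2) * √(tanOfSin b ^ 2 - x ^ 2)) =
      logArcWeight b x + cauchyPotential x := by
    rw [Real.log_mul (by positivity) h5.ne', Real.log_mul (by positivity) h8.ne', h6,
      logArcWeight, log_chordalSq (sub_ne_zero.1 h2.ne'), log_chordalSq (sub_ne_zero.1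
        (by linarith : -tanOfSin b - x < 0).ne), h7, Real.log_abs, neg_sq]
    unfold cauchyPotential
    ring
  rw [← h9, Real.exp_log (by positivity), arcDensityAux, one_div, inv_inv]

lemma measurable_arcDensityAux (b : ℝ) : Measurable (arcDensityAux b) := by
  unfold arcDensityAux; fun_prop

lemma arcDensityAux_pos {b x : ℝ} (h0 : 0 < b) (h1 : b < 1)
    (hx : x ∈ Ioo (-tanOfSin b) (tanOfSin b)) : 0 < arcDensityAux b x := by
  rw [← inv_pos, inv_arcDensityAux h0 h1 hx]; positivity

lemma arcMeasure_eq_withDensity {b : ℝ} (h0 : 0 < b) (h1 : b < 1) :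
    arcMeasure b = (volume.restrict (Icc (-tanOfSin b) (tanOfSin b))).withDensity
      fun x => ENNReal.ofReal (arcDensityAux b x) := by
  rw [← arcMeasure_eq_densityMeasure h0 h1, densityMeasure,
    ← withDensity_indicator measurableSet_Icc]
  congr 1; ext x
  by_cases hx : x ∈ Icc (-tanOfSin b) (tanOfSin b)
  · rw [indicator_of_mem hx, indicator_of_mem hx]
  · rw [indicator_of_notMem hx, indicator_of_notMem hx, ENNReal.ofReal_zero]

lemma ae_restrict_mem_Ioo (a : ℝ) : ∀ᵐ x ∂(volume : Measure ℝ).restrict (Icc (-a) a),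
    x ∈ Ioo (-a) a := by
  rw [← restrict_Ioo_eq_restrict_Icc]
  exact ae_restrict_mem measurableSet_Ioo

/-- The arc density is positive almost everywhere on the arc, so Lebesgue measure there has a
density with respect to the arc measure. -/
lemma volume_restrict_eq {b : ℝ} (h0 : 0 < b) (h1 : b < 1) :
    (volume : Measure ℝ).restrict (Icc (-tanOfSin b) (tanOfSin b)) =
      (arcMeasure b).withDensity fun x => ENNReal.ofReal (arcDensityAux b x)⁻¹ := by
  have hm : Measurable fun x => ENNReal.ofReal (arcDensityAux b x) :=
    (measurable_arcDensityAux b).ennreal_ofReal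
  have h2 : (arcMeasure b).withDensity (fun x => ENNReal.ofReal (arcDensityAux b x)⁻¹) =
      (arcMeasure b).withDensity (fun x => ENNReal.ofReal (arcDensityAux b x))⁻¹ := by
    refine withDensity_congr_ae ?_
    rw [arcMeasure_eq_withDensity h0 h1]
    refine (withDensity_absolutelyContinuous _ _).ae_le ?_
    filter_upwards [ae_restrict_mem_Ioo (tanOfSin b)] with x hx
    exact ENNReal.ofReal_inv_of_pos (arcDensityAux_pos h0 h1 hx)
  rw [h2, arcMeasure_eq_withDensity h0 h1]
  refine (withDensity_inv_same hm ?_ ?_).symm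
  · filter_upwards [ae_restrict_mem_Ioo (tanOfSin b)] with x hx
    simpa using arcDensityAux_pos h0 h1 hx
  · exact Eventually.of_forall fun x => ENNReal.ofReal_ne_top

/-- The partition function is at least `exp (-n² c - n C)`, where `c` is the energy of the arc
measure: Jensen's inequality is applied to the product of `n` copies of the arc measure. -/
lemma exists_le_weightMeasure_univ {b : ℝ} (h0 : 0 < b) (h1 : b < 1) : ∃ C : ℝ, ∀ n : ℕ,
    ENNReal.ofReal (Real.exp (-(n ^ 2 * robinConstant b) + n * C)) ≤
      weightMeasure cauchyPotential ((-tanOfSin b : ℝ) : EReal) (tanOfSin b : EReal) n univ := by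
  have := nullSingletonClass_arcMeasure h0 h1
  refine ⟨∫ x, logArcWeight b x ∂(arcMeasure b), fun n => ?_⟩
  set P : Measure (Fin n → ℝ) := Measure.pi fun _ => arcMeasure b with hP
  have hfin : IsFiniteMeasure ((arcMeasure b).withDensity
      fun x => ENNReal.ofReal (arcDensityAux b x)⁻¹) := by
    rw [← volume_restrict_eq h0 h1]; infer_instance
  have hw : Measurable fun x => ENNReal.ofReal (arcDensityAux b x)⁻¹ :=
    (measurable_arcDensityAux b).inv.ennreal_ofReal
  set Y : (Fin n → ℝ) → ℝ := fun t =>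
    1 / 2 * ∑ i, ∑ j, Real.log (chordalSq (t i) (t j)) + ∑ i, logArcWeight b (t i) with hY
  have i1 : ∀ i j : Fin n, Integrable (fun t : Fin n → ℝ => Real.log (chordalSq (t i) (t j))) P :=
    fun i j => integrable_log_chordalSq_eval h0 h1 i j
  have i2 : ∀ i : Fin n, Integrable (fun t : Fin n → ℝ => logArcWeight b (t i)) P := fun i =>
    integrable_comp_eval (μ := fun _ : Fin n => arcMeasure b) (integrable_logArcWeight h0 h1)
  have i3 : Integrable
      (fun t : Fin n → ℝ => 1 / 2 * ∑ i, ∑ j, Real.log (chordalSq (t i) (t j))) P :=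
    (integrable_finsetSum _ fun i _ => integrable_finsetSum _ fun j _ => i1 i j).const_mul _
  have i4 : Integrable (fun t : Fin n → ℝ => ∑ i, logArcWeight b (t i)) P :=
    integrable_finsetSum _ fun i _ => i2 i
  have hYint : -(n ^ 2 * robinConstant b) + n * ∫ x, logArcWeight b x ∂(arcMeasure b) ≤
      ∫ t, Y t ∂P := by
    rw [hY, integral_add i3 i4, integral_const_mul, integral_finsetSum _ fun i _ =>
      integrable_finsetSum _ fun j _ => i1 i j, integral_finsetSum _ fun i _ => i2 i]
    have e1 : ∀ i : Fin n, ∫ t, logArcWeight b (t i) ∂P = ∫ x, logArcWeight b x ∂(arcMeasure b) :=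
      fun i => integral_comp_eval (μ := fun _ : Fin n => arcMeasure b)
        (integrable_logArcWeight h0 h1).aestronglyMeasurable
    have e2 : ∑ _i : Fin n, ∑ _j : Fin n, -(2 * robinConstant b) ≤
        ∑ i : Fin n, ∫ t, ∑ j, Real.log (chordalSq (t i) (t j)) ∂P := by
      refine Finset.sum_le_sum fun i _ => ?_
      rw [integral_finsetSum _ fun j _ => i1 i j]
      exact Finset.sum_le_sum fun j _ => le_integral_log_chordalSq_eval h0 h1 i j
    simp only [e1]
    simp only [Finset.sum_const, Finset.card_univ, Fintype.card_fin, nsmul_eq_mul] at e2 ⊢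
    linarith
  calc ENNReal.ofReal (Real.exp (-(n ^ 2 * robinConstant b) +
        n * ∫ x, logArcWeight b x ∂(arcMeasure b)))
      ≤ ENNReal.ofReal (Real.exp (∫ t, Y t ∂P)) :=
        ENNReal.ofReal_le_ofReal (Real.exp_le_exp.2 hYint)
    _ ≤ ∫⁻ t, ENNReal.ofReal (Real.exp (Y t)) ∂P :=
        ofReal_exp_integral_le_lintegral P (i3.add i4)
    _ = ∫⁻ t, (∏ i, ENNReal.ofReal (arcDensityAux b (t i))⁻¹) *
          ENNReal.ofReal (gasDensity n t) ∂P := by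
        refine lintegral_congr_ae ?_
        have hmem : ∀ᵐ x ∂(arcMeasure b), x ∈ Ioo (-tanOfSin b) (tanOfSin b) := by
          rw [arcMeasure_eq_withDensity h0 h1]
          exact (withDensity_absolutelyContinuous _ _).ae_le (ae_restrict_mem_Ioo _)
        have hmem' : ∀ᵐ t ∂P, ∀ i, t i ∈ Ioo (-tanOfSin b) (tanOfSin b) :=
          eventually_all.2 fun i =>
            (measurePreserving_eval (fun _ : Fin n => arcMeasure b)
              i).quasiMeasurePreserving.ae hmem
        filter_upwards [hmem', ae_injective_pi (arcMeasure b)] with t ht hinj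
        rw [gasDensity_eq_exp hinj]
        simp only [inv_arcDensityAux h0 h1 (ht _)]
        rw [← ENNReal.ofReal_prod_of_nonneg fun i _ => (Real.exp_pos _).le, ← Real.exp_sum,
          ← ENNReal.ofReal_mul (Real.exp_pos _).le, ← Real.exp_add, Finset.sum_add_distrib]
        congr 2
        rw [hY]; ring
    _ = weightMeasure cauchyPotential ((-tanOfSin b : ℝ) : EReal) (tanOfSin b : EReal) n univ := by
        rw [weightMeasure_eq, withDensity_apply _ MeasurableSet.univ, Measure.restrict_univ,
          volume_restrict_eq h0 h1, pi_withDensity_prod _ hw,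
          lintegral_withDensity_eq_lintegral_mul _ _
            (continuous_gasDensity n).measurable.ennreal_ofReal]
        · rfl
        · exact Finset.measurable_prod _ fun i _ => hw.comp (measurable_pi_apply i)

/-! ### Almost sure convergence of the empirical measures -/

lemma weightMeasure_univ_ne_zero {b : ℝ} (h0 : 0 < b) (h1 : b < 1) (n : ℕ) :
    weightMeasure cauchyPotential ((-tanOfSin b : ℝ) : EReal) (tanOfSin b : EReal) n univ ≠ 0 := by
  obtain ⟨C, hC⟩ := exists_le_weightMeasure_univ h0 h1
  exact (lt_of_lt_of_le (ENNReal.ofReal_pos.2 (Real.exp_pos _)) (hC n)).ne'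

lemma isProbabilityMeasure_eigenvalueLaw {b : ℝ} (h0 : 0 < b) (h1 : b < 1) (n : ℕ) :
    IsProbabilityMeasure
      (eigenvalueLaw cauchyPotential ((-tanOfSin b : ℝ) : EReal) (tanOfSin b : EReal) n) := by
  constructor
  rw [eigenvalueLaw, Measure.smul_apply, smul_eq_mul]
  exact ENNReal.inv_mul_cancel (weightMeasure_univ_ne_zero h0 h1 n)
    (weightMeasure_univ_ne_top (tanOfSin_pos h0 h1) n)

lemma ae_eigenvalueLaw_mem (a : ℝ) (n : ℕ) :
    ∀ᵐ t ∂(eigenvalueLaw cauchyPotential ((-a : ℝ) : EReal) (a : EReal) n),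
      ∀ i, t i ∈ Icc (-a) a := by
  refine Measure.ae_smul_measure ?_ _
  rw [weightMeasure_eq]
  exact (withDensity_absolutelyContinuous _ _).ae_le (ae_mem_pi_Icc a n)

/-- An atypical moment has probability at most `exp (-κ n² + C n)`. -/
lemma exists_eigenvalueLaw_momentEvent_le {b : ℝ} (h0 : 0 < b) (h1 : b < 1) {m : ℕ} (hm : 1 ≤ m)
    {δ : ℝ} (hδ : 0 < δ) : ∃ κ > 0, ∃ C : ℝ, ∀ n : ℕ, 1 ≤ n →
      eigenvalueLaw cauchyPotential ((-tanOfSin b : ℝ) : EReal) (tanOfSin b : EReal) n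
        (momentEvent n m δ (moment (arcMeasure b) m)) ≤
      ENNReal.ofReal (Real.exp (-(κ * n ^ 2) + C * n)) := by
  obtain ⟨κ, hκ, C, hC⟩ := exists_weightMeasure_momentEvent_le h0 h1 hm hδ
  obtain ⟨D, hD⟩ := exists_le_weightMeasure_univ h0 h1
  refine ⟨κ, hκ, C - D, fun n hn => ?_⟩
  rw [eigenvalueLaw, Measure.smul_apply, smul_eq_mul]
  calc _ ≤ (ENNReal.ofReal (Real.exp (-(n ^ 2 * robinConstant b) + n * D)))⁻¹ *
        ENNReal.ofReal (Real.exp (-(n ^ 2 * (robinConstant b + κ)) + n * C)) :=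
        mul_le_mul' (ENNReal.inv_le_inv.2 (hD n)) (hC n hn)
    _ = _ := by
        rw [← ENNReal.ofReal_inv_of_pos (Real.exp_pos _), ← Real.exp_neg,
          ← ENNReal.ofReal_mul (Real.exp_pos _).le, ← Real.exp_add]
        congr 2; ring

lemma summable_exp_neg_sq_add {κ : ℝ} (hκ : 0 < κ) (C : ℝ) :
    Summable fun n : ℕ => Real.exp (-(κ * n ^ 2) + C * n) := by
  refine Summable.of_nonneg_of_le (fun n => (Real.exp_pos _).le) (fun n => ?_)
    (Real.summable_exp_neg_nat.mul_left (Real.exp ((C + 1) ^ 2 / (4 * κ))))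
  rw [← Real.exp_add, Real.exp_le_exp]
  -- Completing the square: `(C + 1) n - κ n² ≤ (C + 1)² / (4 κ)`.
  have h : (C + 1) ^ 2 / (4 * κ) + -(n : ℝ) - (-(κ * n ^ 2) + C * n) =
      (C + 1 - 2 * κ * n) ^ 2 / (4 * κ) := by field_simp; ring
  have : 0 ≤ (C + 1 - 2 * κ * n) ^ 2 / (4 * κ) := by positivity
  linarith

/-- Borel–Cantelli for the moments. Only the marginal laws enter, so the joint law `P` is
arbitrary. -/
lemma ae_eventually_moment_lt {b : ℝ} (h0 : 0 < b) (h1 : b < 1)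
    {P : Measure ((n : ℕ) → (Fin n → ℝ))}
    (hP : ∀ n, P.map (fun t => t n) =
      eigenvalueLaw cauchyPotential ((-tanOfSin b : ℝ) : EReal) (tanOfSin b : EReal) n)
    {m : ℕ} (hm : 1 ≤ m) {δ : ℝ} (hδ : 0 < δ) :
    ∀ᵐ t ∂P, ∀ᶠ n in atTop,
      ‖moment (empiricalMeasure n (t n)) m - moment (arcMeasure b) m‖ < δ := by
  obtain ⟨κ, hκ, C, hC⟩ := exists_eigenvalueLaw_momentEvent_le h0 h1 hm hδ
  -- For `n = 0` the empirical measure is zero and the bound is not available; the event is dropped.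
  set S : ℕ → Set ((n : ℕ) → (Fin n → ℝ)) := fun n =>
    {t | 1 ≤ n ∧ t n ∈ momentEvent n m δ (moment (arcMeasure b) m)} with hS
  have hle : ∀ n, P (S n) ≤ ENNReal.ofReal (Real.exp (-(κ * n ^ 2) + C * n)) := by
    intro n
    rcases Nat.eq_zero_or_pos n with rfl | hn
    · have : S 0 = ∅ := eq_empty_of_forall_notMem fun t ht => absurd ht.1 (by norm_num)
      simp [this]
    · refine le_trans ?_ (hC n hn)
      rw [← hP n]
      exact (measure_mono fun t ht => ht.2).trans
        (Measure.le_map_apply (measurable_pi_apply n).aemeasurable _)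
  have hsum : ∑' n, P (S n) ≠ ⊤ :=
    ne_top_of_le_ne_top (summable_exp_neg_sq_add hκ C).tsum_ofReal_ne_top
      (ENNReal.tsum_le_tsum hle)
  filter_upwards [ae_eventually_notMem hsum] with t ht
  filter_upwards [ht, eventually_ge_atTop 1] with n hn hn1
  by_contra hcon
  exact hn ⟨hn1, not_lt.1 hcon⟩

lemma isLimitingEigenvalueMeasure_arcMeasure {b : ℝ} (h0 : 0 < b) (h1 : b < 1) :
    IsLimitingEigenvalueMeasure cauchyPotential ((-tanOfSin b : ℝ) : EReal) (tanOfSin b : EReal)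
      (arcMeasure b) := by
  refine ⟨inferInstance, fun P _ hlaw => ?_⟩
  have hmem : ∀ᵐ t ∂P, ∀ n, ∀ i, t n i ∈ Icc (-tanOfSin b) (tanOfSin b) := by
    refine ae_all_iff.2 fun n => ?_
    have := ae_eigenvalueLaw_mem (tanOfSin b) n
    rw [← hlaw n] at this
    exact ae_of_ae_map (measurable_pi_apply n).aemeasurable this
  have hmom : ∀ᵐ t ∂P, ∀ m k : ℕ, 1 ≤ m → ∀ᶠ n in atTop,
      ‖moment (empiricalMeasure n (t n)) m - moment (arcMeasure b) m‖ < 1 / ((k : ℝ) + 1) := by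
    refine ae_all_iff.2 fun m => ae_all_iff.2 fun k => ?_
    by_cases hm : 1 ≤ m
    · filter_upwards [ae_eventually_moment_lt h0 h1 hlaw hm
        (Nat.one_div_pos_of_nat (α := ℝ) (n := k))] with t ht _ using ht
    · exact Eventually.of_forall fun t h => absurd h hm
  filter_upwards [hmem, hmom] with t ht1 ht2 f
  refine tendsto_integral_of_tendsto_moment isCompact_Icc (arcMeasure_compl_Icc h0 h1) ?_ ?_ f
  · filter_upwards [eventually_ge_atTop 1] with n hn
    exact ⟨isProbabilityMeasure_empiricalMeasure hn _,
      empiricalMeasure_compl measurableSet_Icc (ht1 n)⟩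
  · intro m hm
    rw [Metric.tendsto_nhds]
    intro δ hδ
    obtain ⟨k, hk⟩ := exists_nat_one_div_lt hδ
    filter_upwards [ht2 m k hm] with n hn
    rw [dist_eq_norm]
    exact hn.trans hk

/-- The limit is unique because independent eigenvalue vectors form one admissible joint law. -/
lemma IsLimitingEigenvalueMeasure.unique {V : ℝ → ℝ} {bm bp : EReal} {μ ν : Measure ℝ}
    (hV : ∀ n, IsProbabilityMeasure (eigenvalueLaw V bm bp n))
    (hμ : IsLimitingEigenvalueMeasure V bm bp μ) (hν : IsLimitingEigenvalueMeasure V bm bp ν) :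
    ν = μ := by
  have := hμ.isProbability
  have := hν.isProbability
  have hP : ∀ n, (Measure.infinitePi (eigenvalueLaw V bm bp)).map (fun t => t n) =
      eigenvalueLaw V bm bp n := fun n => Measure.infinitePi_map_eval _ n
  obtain ⟨t, h1, h2⟩ := ((hμ.tendsto _ inferInstance hP).and (hν.tendsto _ inferInstance hP)).exists
  exact ext_of_forall_integral_eq_of_IsFiniteMeasure fun f => tendsto_nhds_unique (h2 f) (h1 f)

/-! ### The arc measure is the equilibrium measure -/

lemma energyKernel_cauchyPotential_of_ne {p : ℝ × ℝ} (hp : p.1 ≠ p.2) :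
    energyKernel cauchyPotential p = ((-(1 / 2) * Real.log (chordalSq p.1 p.2) : ℝ) : EReal) := by
  rw [energyKernel, if_neg hp, log_chordalSq hp]
  unfold cauchyPotential
  congr 1; ring

lemma energyKernel_cauchyPotential_nonneg (p : ℝ × ℝ) : 0 ≤ energyKernel cauchyPotential p := by
  by_cases hp : p.1 = p.2
  · rw [energyKernel, if_pos hp]; exact le_top
  · rw [energyKernel_cauchyPotential_of_ne hp, EReal.coe_nonneg]
    linarith [log_chordalSq_nonpos p.1 p.2]

lemma energy_cauchyPotential (ν : Measure ℝ) : energy cauchyPotential ν =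
    ((∫⁻ p, (energyKernel cauchyPotential p).toENNReal ∂(ν.prod ν) : ENNReal) : EReal) := by
  have : ∀ p, (-energyKernel cauchyPotential p).toENNReal = 0 := fun p =>
    EReal.toENNReal_of_nonpos (EReal.neg_le_zero.2 (energyKernel_cauchyPotential_nonneg p))
  simp [energy, this]

lemma energy_arcMeasure {b : ℝ} (h0 : 0 < b) (h1 : b < 1) :
    energy cauchyPotential (arcMeasure b) = (ENNReal.ofReal (robinConstant b) : EReal) := by
  have := nullSingletonClass_arcMeasure h0 h1
  rw [energy_cauchyPotential]
  congr 1
  have e : robinConstant b = ∫ p : ℝ × ℝ, -(1 / 2) * Real.log (chordalSq p.1 p.2)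
      ∂((arcMeasure b).prod (arcMeasure b)) := by
    rw [integral_const_mul, integral_log_chordalSq_prod h0 h1]; ring
  rw [e, ofReal_integral_eq_lintegral_ofReal ((integrable_log_chordalSq_prod h0 h1).const_mul _)]
  · refine lintegral_congr_ae ?_
    filter_upwards [ae_prod_ne (arcMeasure b) (arcMeasure b)] with p hp
    rw [energyKernel_cauchyPotential_of_ne hp, EReal.real_coe_toENNReal]
  · exact Eventually.of_forall fun p => by
      have := log_chordalSq_nonpos p.1 p.2
      simp only [Pi.zero_apply]
      linarith

lemma ofReal_integral_le_lintegral {Ω : Type*} [MeasurableSpace Ω] {μ : Measure Ω} {f : Ω → ℝ}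
    (hf : Integrable f μ) : ENNReal.ofReal (∫ ω, f ω ∂μ) ≤ ∫⁻ ω, ENNReal.ofReal (f ω) ∂μ := by
  rw [integral_eq_lintegral_pos_part_sub_lintegral_neg_part hf]
  exact (ENNReal.ofReal_le_ofReal (sub_le_self _ ENNReal.toReal_nonneg)).trans
    ENNReal.ofReal_toReal_le

/-- On the diagonal the energy kernel is `⊤`, so the inequality between the kernels holds
everywhere, also for measures with atoms. -/
lemma ofReal_regEnergy_le_energy {h : ℝ} (hh : 0 < h) (ν : Measure ℝ) [IsFiniteMeasure ν] :
    (ENNReal.ofReal (regEnergy h ν ν) : EReal) ≤ energy cauchyPotential ν := by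
  rw [energy_cauchyPotential, EReal.coe_ennreal_le_coe_ennreal_iff]
  refine (ofReal_integral_le_lintegral (integrable_regKernel hh _)).trans
    (lintegral_mono fun p => ?_)
  by_cases hp : p.1 = p.2
  · simp [energyKernel, hp]
  · rw [energyKernel_cauchyPotential_of_ne hp, EReal.real_coe_toENNReal]
    exact ENNReal.ofReal_le_ofReal (regKernel_le_log hh hp)

/-- A competitor differs from the arc measure in some moment, so the energy gap applies to it. -/
lemma isEquilibriumMeasure_arcMeasure {b : ℝ} (h0 : 0 < b) (h1 : b < 1) :
    IsEquilibriumMeasure cauchyPotential ((-tanOfSin b : ℝ) : EReal) (tanOfSin b : EReal)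
      (arcMeasure b) where
  isProbability := inferInstance
  domain_compl := by rw [domain_coe]; exact arcMeasure_compl_Icc h0 h1
  energy_ne_bot := by rw [energy_arcMeasure h0 h1]; exact EReal.coe_ennreal_ne_bot _
  energy_ne_top := by rw [energy_arcMeasure h0 h1]; simp
  energy_lt := by
    intro ν _ hν hne
    rw [domain_coe] at hν
    have : ∃ m : ℕ, 1 ≤ m ∧ moment ν m ≠ moment (arcMeasure b) m := by
      by_contra! hcon
      exact hne (eq_of_moment_eq isCompact_Icc (arcMeasure_compl_Icc h0 h1) hν hcon)
    obtain ⟨m, hm, hmne⟩ := this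
    obtain ⟨h, hh, κ, hκ, H⟩ := exists_regEnergy_gap h0 h1 hm
      (norm_pos_iff.2 (sub_ne_zero.2 hmne))
    have hle := H ν inferInstance hν le_rfl
    rw [energy_arcMeasure h0 h1]
    refine lt_of_lt_of_le ?_ (ofReal_regEnergy_le_energy hh ν)
    rw [EReal.coe_ennreal_lt_coe_ennreal_iff, ENNReal.ofReal_lt_ofReal_iff_of_nonneg
      (robinConstant_nonneg h0 h1)]
    linarith

/-! ### The Borot–Guionnet conditions -/

lemma support_arcMeasure {b : ℝ} (h0 : 0 < b) (h1 : b < 1) :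
    (arcMeasure b).support = Icc (-tanOfSin b) (tanOfSin b) := by
  have ha := tanOfSin_pos h0 h1
  refine Subset.antisymm (Measure.support_subset_of_isClosed isClosed_Icc
    (arcMeasure_compl_Icc h0 h1)) fun x hx => ?_
  rw [Measure.mem_support_iff_forall]
  intro U hU
  rw [pos_iff_ne_zero]
  intro hU0
  have hac : (volume : Measure ℝ).restrict (Icc (-tanOfSin b) (tanOfSin b)) ≪ arcMeasure b := by
    rw [volume_restrict_eq h0 h1]
    exact withDensity_absolutelyContinuous _ _
  have hv : (volume : Measure ℝ) (interior U ∩ Ioo (-tanOfSin b) (tanOfSin b)) = 0 := by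
    refine measure_mono_null (inter_subset_inter interior_subset Ioo_subset_Icc_self) ?_
    exact le_antisymm ((Measure.le_restrict_apply _ _).trans_eq (hac hU0)) bot_le
  have hopen : IsOpen (interior U ∩ Ioo (-tanOfSin b) (tanOfSin b)) :=
    isOpen_interior.inter isOpen_Ioo
  rw [hopen.measure_eq_zero_iff (μ := (volume : Measure ℝ))] at hv
  rw [← closure_Ioo (by linarith : -tanOfSin b ≠ tanOfSin b)] at hx
  obtain ⟨y, hy⟩ := mem_closure_iff.1 hx _ isOpen_interior (mem_interior_iff_mem_nhds.2 hU)
  exact (hv ▸ hy : y ∈ (∅ : Set ℝ))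

lemma ae_log_abs_sub_eq {b : ℝ} (h0 : 0 < b) (h1 : b < 1) (x : ℝ) :
    (fun ξ => (Real.log (chordalSq x ξ) + cauchyPotential x + cauchyPotential ξ) / 2)
      =ᵐ[arcMeasure b] fun ξ => Real.log |x - ξ| := by
  have := nullSingletonClass_arcMeasure h0 h1
  have hne : ∀ᵐ y ∂(arcMeasure b), y ≠ x := by simp [ae_iff]
  filter_upwards [hne] with y hy
  rw [log_chordalSq hy.symm]
  unfold cauchyPotential
  ring

lemma integrable_log_abs_sub {b : ℝ} (h0 : 0 < b) (h1 : b < 1) {x : ℝ}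
    (hx : x ∈ Icc (-tanOfSin b) (tanOfSin b)) :
    Integrable (fun ξ => Real.log |x - ξ|) (arcMeasure b) :=
  ((((integrable_log_chordalSq h0 h1 hx).add (integrable_const _)).add
    (integrable_cauchyPotential h0 h1)).div_const 2).congr (ae_log_abs_sub_eq h0 h1 x)

/-- The effective potential is constant on the arc. -/
lemma effectivePotential_arcMeasure {b : ℝ} (h0 : 0 < b) (h1 : b < 1) {x : ℝ}
    (hx : x ∈ Icc (-tanOfSin b) (tanOfSin b)) :
    effectivePotential cauchyPotential (arcMeasure b) x =
      robinConstant b - (∫ ξ, cauchyPotential ξ ∂(arcMeasure b)) / 2 := by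
  have hi := integrable_log_chordalSq h0 h1 hx
  have hi' : Integrable (fun ξ => Real.log (chordalSq x ξ) + cauchyPotential x) (arcMeasure b) :=
    hi.add (integrable_const _)
  rw [effectivePotential, ← integral_congr_ae (ae_log_abs_sub_eq h0 h1 x), integral_div,
    integral_add hi' (integrable_cauchyPotential h0 h1), integral_add hi (integrable_const _),
    integral_log_chordalSq h0 h1 hx, robinConstant]
  simp
  ring

lemma continuousOn_arcDensityAux {b : ℝ} (h0 : 0 < b) (h1 : b < 1) :
    ContinuousOn (arcDensityAux b) (Ioo (-tanOfSin b) (tanOfSin b)) := by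
  unfold arcDensityAux
  refine ContinuousOn.div (by fun_prop) (by fun_prop) fun x hx => ?_
  have hq : 0 < √(1 - b ^ 2) := Real.sqrt_pos.2 (by nlinarith)
  have h2 : 0 < √(tanOfSin b ^ 2 - x ^ 2) := Real.sqrt_pos.2 (by nlinarith [hx.1, hx.2])
  have := Real.pi_pos
  positivity

/-- The density is of exact order `|x - c| ^ (-1/2)` at either edge `c` of the arc, from the
inside. -/
lemma arcDensityAux_isTheta {b c : ℝ} (h0 : 0 < b) (h1 : b < 1) (hc : c ^ 2 = tanOfSin b ^ 2)
    {l : Filter ℝ} (hl : l ≤ 𝓝 c) (hmem : Ioo (-tanOfSin b) (tanOfSin b) ∈ l) :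
    arcDensityAux b =Θ[l] fun x => 1 / Real.sqrt |x - c| := by
  have ha := tanOfSin_pos h0 h1
  have hc0 : c ≠ 0 := fun h => by rw [h] at hc; nlinarith
  have hq : 0 < √(1 - b ^ 2) := Real.sqrt_pos.2 (by nlinarith)
  have hs : 0 < √|c + c| := Real.sqrt_pos.2 (abs_pos.2 (by simpa [← two_mul] using hc0))
  -- The edge factor `√|x - c|` splits off from the density; the rest is continuous at `c`.
  set g : ℝ → ℝ := fun x => 1 / (Real.pi * √(1 - b ^ 2) * (1 + x ^ 2) * √|x + c|) with hg
  have hgc : 0 < g c := by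
    have := Real.pi_pos
    simp only [hg]; positivity
  have hgt : Tendsto g l (𝓝 (g c)) := by
    refine Tendsto.mono_left (ContinuousAt.tendsto ?_) hl
    refine ContinuousAt.div (by fun_prop) (by fun_prop) ?_
    have := Real.pi_pos
    positivity
  refine (Asymptotics.isTheta_of_div_tendsto_nhds_ne_zero (c := g c) (hgt.congr' ?_) hgc.ne').symm
  filter_upwards [hmem] with x hx
  have h2 : 0 < tanOfSin b ^ 2 - x ^ 2 := by nlinarith [hx.1, hx.2]
  have h3 : √(tanOfSin b ^ 2 - x ^ 2) = √|x - c| * √|x + c| := by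
    rw [← Real.sqrt_mul (abs_nonneg _), ← abs_mul, ← abs_of_pos h2, ← hc, abs_sub_comm]
    congr 2; ring
  have h4 : 0 < √|x - c| := by
    refine lt_of_le_of_ne (Real.sqrt_nonneg _) fun h => ?_
    have h5 := Real.sqrt_pos.2 h2
    rw [h3, ← h, zero_mul] at h5
    exact lt_irrefl _ h5
  rw [arcDensityAux, h3, hg]
  field_simp

lemma borotGuionnetConditions_arc {b : ℝ} (h0 : 0 < b) (h1 : b < 1) :
    BorotGuionnetConditions cauchyPotential ((-tanOfSin b : ℝ) : EReal) (tanOfSin b : EReal)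
      (-tanOfSin b) (tanOfSin b)
      ((Icc (-tanOfSin b) (tanOfSin b)).indicator (arcDensityAux b)) := by
  have ha := tanOfSin_pos h0 h1
  have hrho : EqOn ((Icc (-tanOfSin b) (tanOfSin b)).indicator (arcDensityAux b))
      (arcDensityAux b) (Ioo (-tanOfSin b) (tanOfSin b)) := fun x hx =>
    indicator_of_mem (Ioo_subset_Icc_self hx) _
  have hleft : Ioo (-tanOfSin b) (tanOfSin b) ∈ 𝓝[>] (-tanOfSin b) :=
    Ioo_mem_nhdsGT (by linarith)
  have hright : Ioo (-tanOfSin b) (tanOfSin b) ∈ 𝓝[<] (tanOfSin b) :=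
    Ioo_mem_nhdsLT (by linarith)
  have hmin : ∀ x ∈ Icc (-tanOfSin b) (tanOfSin b) \ Ioo (-tanOfSin b) (tanOfSin b),
      IsMinOn (effectivePotential cauchyPotential (arcMeasure b))
        (Icc (-tanOfSin b) (tanOfSin b) \ Ioo (-tanOfSin b) (tanOfSin b)) x := by
    intro x hx y hy
    exact ((effectivePotential_arcMeasure h0 h1 hx.1).trans
      (effectivePotential_arcMeasure h0 h1 hy.1).symm).le
  constructor
  · exact continuous_cauchyPotential.continuousOn
  · exact fun h => absurd h (EReal.coe_ne_top _)
  · exact fun h => absurd h (EReal.coe_ne_bot _)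
  · rw [arcMeasure_eq_densityMeasure h0 h1, support_arcMeasure h0 h1]
  · linarith
  · rw [domain_coe, arcMeasure_eq_densityMeasure h0 h1]
    exact fun x hx => integrable_log_abs_sub h0 h1 hx.1
  · rw [domain_coe, arcMeasure_eq_densityMeasure h0 h1]
    have hx : tanOfSin b ∈ Icc (-tanOfSin b) (tanOfSin b) \ Ioo (-tanOfSin b) (tanOfSin b) :=
      ⟨right_mem_Icc.2 (by linarith), fun h => lt_irrefl _ h.2⟩
    exact ⟨_, hx, hmin _ hx⟩
  · rw [domain_coe]
    intro x hx _
    by_contra! hcon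
    exact hx.2 ⟨lt_of_le_of_ne hx.1.1 hcon.1.symm, lt_of_le_of_ne hx.1.2 hcon.2⟩
  · exact (continuousOn_arcDensityAux h0 h1).congr hrho
  · intro x hx
    rw [hrho hx]
    exact arcDensityAux_pos h0 h1 hx
  · intro _
    exact (hrho.eventuallyEq_of_mem hleft).trans_isTheta
      (arcDensityAux_isTheta h0 h1 (neg_sq _) nhdsWithin_le_nhds hleft)
  · intro _
    exact (hrho.eventuallyEq_of_mem hright).trans_isTheta
      (arcDensityAux_isTheta h0 h1 rfl nhdsWithin_le_nhds hright)
  · exact fun h => absurd rfl h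
  · exact fun h => absurd rfl h
  · refine ⟨{z : ℂ | 1 + z ^ 2 ∈ Complex.slitPlane}, fun z => Complex.log (1 + z ^ 2),
      ?_, ?_, ?_, ?_⟩
    · exact Complex.isOpen_slitPlane.preimage (by fun_prop)
    · intro x _
      have : (1 + (x : ℂ) ^ 2) = ((1 + x ^ 2 : ℝ) : ℂ) := by push_cast; rfl
      change 1 + (x : ℂ) ^ 2 ∈ Complex.slitPlane
      rw [this, Complex.ofReal_mem_slitPlane]
      positivity
    · intro z hz
      exact AnalyticAt.clog (by fun_prop) hz
    · intro x _ _
      have : (1 + (x : ℂ) ^ 2) = ((1 + x ^ 2 : ℝ) : ℂ) := by push_cast; rfl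
      change Complex.log (1 + (x : ℂ) ^ 2) = _
      rw [this, ← Complex.ofReal_log (by positivity)]
      rfl

lemma tanOfSin_sin {s : ℝ} (h0 : 0 ≤ s) (h1 : s < Real.pi / 2) :
    tanOfSin (Real.sin s) = Real.tan s := by
  have hc := Real.cos_nonneg_of_neg_pi_div_two_le_of_le (by linarith) h1.le
  rw [tanOfSin, ← Real.cos_eq_sqrt_one_sub_sin_sq (by linarith) h1.le, Real.tan_eq_sin_div_cos]

lemma arcDensity_eq {ε : ℝ} (h0 : 0 < ε) (h1 : ε < 1) : arcDensity ε =
    (Icc (-tanOfSin (Real.sin (Real.pi * ε / 2))) (tanOfSin (Real.sin (Real.pi * ε / 2)))).indicator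
      (arcDensityAux (Real.sin (Real.pi * ε / 2))) := by
  have hs0 : 0 < Real.pi * ε / 2 := by have := Real.pi_pos; positivity
  have hs1 : Real.pi * ε / 2 < Real.pi / 2 := by nlinarith [Real.pi_pos]
  unfold arcDensity arcDensityAux
  rw [tanOfSin_sin hs0.le hs1, ← Real.cos_eq_sqrt_one_sub_sin_sq (by linarith) hs1.le]

end LogGas

theorem mainTheorem9 (ε : ℝ) (hε0 : 0 < ε) (hε1 : ε < 1) (a : ℝ)
    (ha : a = Real.tan (Real.pi * ε / 2)) (V : ℝ → ℝ) (hV : ∀ x, V x = Real.log (1 + x ^ 2)) :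
    LogGas.IsLimitingEigenvalueMeasure V ((-a : ℝ) : EReal) (a : EReal)
        (LogGas.densityMeasure (LogGas.arcDensity ε)) ∧
      (∀ ν : MeasureTheory.Measure ℝ,
        LogGas.IsLimitingEigenvalueMeasure V ((-a : ℝ) : EReal) (a : EReal) ν →
          ν = LogGas.densityMeasure (LogGas.arcDensity ε)) ∧
      LogGas.IsEquilibriumMeasure V ((-a : ℝ) : EReal) (a : EReal)
        (LogGas.densityMeasure (LogGas.arcDensity ε)) ∧
      LogGas.BorotGuionnetConditions V ((-a : ℝ) : EReal) (a : EReal) (-a) a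
        (LogGas.arcDensity ε) := by
  have hs0 : 0 < Real.pi * ε / 2 := by have := Real.pi_pos; positivity
  have hs1 : Real.pi * ε / 2 < Real.pi / 2 := by nlinarith [Real.pi_pos]
  obtain rfl : V = LogGas.cauchyPotential := funext hV
  rw [← LogGas.tanOfSin_sin hs0.le hs1] at ha
  rw [LogGas.arcDensity_eq hε0 hε1]
  have h0 : 0 < Real.sin (Real.pi * ε / 2) :=
    Real.sin_pos_of_pos_of_lt_pi hs0 (by linarith [Real.pi_pos])
  have h1 : Real.sin (Real.pi * ε / 2) < 1 := by
    rw [← Real.sin_pi_div_two]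
    exact Real.sin_lt_sin_of_lt_of_le_pi_div_two (by linarith) le_rfl hs1
  generalize Real.sin (Real.pi * ε / 2) = b at ha h0 h1 ⊢
  subst ha
  refine ⟨?_, ?_, ?_, LogGas.borotGuionnetConditions_arc h0 h1⟩ <;>
    rw [LogGas.arcMeasure_eq_densityMeasure h0 h1]
  · exact LogGas.isLimitingEigenvalueMeasure_arcMeasure h0 h1
  · exact fun ν hν => LogGas.IsLimitingEigenvalueMeasure.unique
      (LogGas.isProbabilityMeasure_eigenvalueLaw h0 h1)
      (LogGas.isLimitingEigenvalueMeasure_arcMeasure h0 h1) hν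
  · exact LogGas.isEquilibriumMeasure_arcMeasure h0 h1
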